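/- A balanced bichromatic point set is a set $S=R\cup B$ in the Euclidean plane, where $R$ (the red points) and $B$ (the blue points) are disjoint finite sets with $|R|=|B|=n$. The set $S$ is in general position if no three different points of $S$ are collinear; different pairs of points of $S$ may span parallel lines. Choose for every point of $S$ a closed ray with that point as its apex, such that the chosen rays are pairwise disjoint, and give every ray the color of its apex. The rays meet every sufficiently large circle in $2n$ points, and the colors of these points, read clockwise along the circle, form a circular sequence (a word of length $2n$ up to cyclic rotation) with $n$ red and $n$ blue elements. A circular sequence that arises in this way is called a feasible configuration of $S$. Let $\gamma(S)$ be the number of different feasible configurations of $S$, and let $\gamma^{\min}_{\mathrm{gp}}(n)$ be the minimum of $\gamma(S)$ over all balanced bichromatic sets $S$ of $2n$ points in general position. **Theorem.** There is an absolute constant $c>0$ such that for every integer $n\ge 1$ and every balanced bichromatic set $S$ of $2n$ points in general position, $$\gamma(S)\;\ge\; c\cdot\frac{2^{\,n^{1/3}}}{n}.$$ Hence $\gamma^{\min}_{\mathrm{gp}}(n)=\Omega\!\left(2^{\,n^{1/3}}/n\right)$ as $n\to\infty$. -/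

import Mathlib

/-- The Euclidean plane. -/
abbrev Plane : Type := EuclideanSpace ℝ (Fin 2)

/-- The two colors of a bichromatic point set. -/
inductive RayColor : Type
  | red
  | blue

/-- The ray with apex `p` and direction vector `v`. -/
def ray (p v : Plane) : Set Plane := {x | ∃ t : ℝ, 0 ≤ t ∧ x = p + t • v}

/-- The point with polar angle `θ` on the circle of radius `ρ` around the origin. -/
noncomputable def circlePoint (ρ θ : ℝ) : Plane := !₂[ρ * Real.cos θ, ρ * Real.sin θ]

/-- `R` (red) and `B` (blue) form a balanced bichromatic point set with `n` points per color. -/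
def IsBalancedBichromatic (n : ℕ) (R B : Finset Plane) : Prop :=
  Disjoint R B ∧ R.card = n ∧ B.card = n

/-- General position: no three different points of `S` are collinear. Different pairs of points
may span parallel lines. -/
def InGeneralPosition (S : Set Plane) : Prop :=
  ∀ p ∈ S, ∀ q ∈ S, ∀ r ∈ S, p ≠ q → p ≠ r → q ≠ r → ¬ Collinear ℝ {p, q, r}

/-- The function `v` assigns to every point `p` of `S` the direction of a ray `ray p (v p)` from
`p`, and these rays are pairwise disjoint. The values of `v` outside `S` play no role. -/
def IsDisjointRaySystem (S : Set Plane) (v : Plane → Plane) : Prop :=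
  (∀ p ∈ S, v p ≠ 0) ∧ S.Pairwise fun p q => Disjoint (ray p (v p)) (ray q (v q))

/-- The list `L` contains the apices of the rays in the clockwise order in which the rays meet
every sufficiently large circle, starting from one of them: polar angles of the intersection points
can be chosen strictly decreasing along `L`, within one full turn. -/
def IsClockwiseOrderAtInfinity (v : Plane → Plane) (L : List Plane) : Prop :=
  ∀ᶠ ρ : ℝ in Filter.atTop, ∃ θ : Plane → ℝ,
    (∀ p ∈ L, circlePoint ρ (θ p) ∈ ray p (v p)) ∧
    L.Pairwise fun p q => θ q < θ p ∧ θ p - θ q < 2 * Real.pi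

open Classical in
/-- The color of a point of `R ∪ B`. -/
noncomputable def pointColor (R : Finset Plane) (p : Plane) : RayColor :=
  if p ∈ R then RayColor.red else RayColor.blue

/-- The circular color sequence `C` is feasible from the point set with red points `R` and blue
points `B`: some pairwise disjoint rays from the points induce it at infinity, in clockwise
order. -/
def IsFeasible (R B : Finset Plane) (C : Cycle RayColor) : Prop :=
  ∃ v : Plane → Plane, IsDisjointRaySystem ((R : Set Plane) ∪ (B : Set Plane)) v ∧
    ∃ L : List Plane, L.Nodup ∧ (∀ p, p ∈ L ↔ p ∈ R ∨ p ∈ B) ∧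
      IsClockwiseOrderAtInfinity v L ∧ C = (L.map (pointColor R) : Cycle RayColor)

/-- The number of different feasible configurations. -/
noncomputable def gammaCount (R B : Finset Plane) : ℕ :=
  Set.ncard {C : Cycle RayColor | IsFeasible R B C}

/-- The minimum of `gammaCount` over the balanced bichromatic sets of `2 * n` points in general
position. -/
noncomputable def gammaMinGP (n : ℕ) : ℕ :=
  sInf {k : ℕ | ∃ R B : Finset Plane, IsBalancedBichromatic n R B ∧
    InGeneralPosition ((R : Set Plane) ∪ (B : Set Plane)) ∧ gammaCount R B = k}

namespace ColoredRays
open Filter Topology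

/-! A vertical line leaves about half of one color class on its left and about half of the other on
its right (`exists_vertical_separation`). Removing upper common tangents of the two halves one after
the other gives a stack of about n/2 bichromatic pairs, each lying below the lines of all earlier
pairs (`exists_stack`). Only the order of the slopes along the stack then matters.

Weakly decreasing slopes: send all rays to the right and sweep downwards. At a pair of slope s, the
points on or above its line may be shot with a slope slightly above or slightly below s. Both
choices emit the same points, but the last one is a different endpoint of the pair, hence of a
different color. After the upper choice every later pair stays available, after the lower choice
only the pairs of slope less than s. This is the recursion for the number of strictly decreasing
sublists, `countDec`, so there are at least that many words (`exists_finset_slopeWords`). Strictly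
increasing slopes reduce to this by reflection (`two_pow_le_of_increasing`). Equal slopes allow all
rays to be parallel, with either point of each pair sent to the left (`exists_finset_of_parallel`);
the colors of the left-going rays encode the choices.

With k + 1 about n^(1/3), the Erdős–Szekeres argument `exists_sublist_trichotomy` finds k + 1
increasing slopes, k + 1 equal slopes, or a weakly decreasing sublist with at least 2^(k+1) strictly
decreasing sublists. Each case gives 2^(k+1) words of length 2n. A circular sequence has at most 2n
rotations, whence the division by n (`card_le_mul_gammaCount`). -/

/-- The height at which the line of slope `s` through `p` meets the vertical axis. -/
def height (s : ℝ) (p : Plane) : ℝ := p 1 - s * p 0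

/-- For rays going to the right with slopes `σ`, the ray of `q` stays below the line that carries
the ray of `p`. -/
def IsAbove (σ : Plane → ℝ) (p q : Plane) : Prop :=
  σ q ≤ σ p ∧ height (σ p) q < height (σ p) p

/-! ### Collinearity through heights; disjointness of right-going rays -/

lemma plane_ext {p q : Plane} (h0 : p 0 = q 0) (h1 : p 1 = q 1) : p = q := by
  ext i; fin_cases i <;> assumption

lemma collinear_of_height_eq {s : ℝ} {p q r : Plane} (hq : height s q = height s p)
    (hr : height s r = height s p) : Collinear ℝ {p, q, r} := by
  rw [collinear_iff_exists_forall_eq_smul_vadd]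
  refine ⟨p, !₂[1, s], fun x hx => ⟨x 0 - p 0, ?_⟩⟩
  have hx' : height s x = height s p := by
    rcases hx with rfl | rfl | rfl
    · rfl
    · exact hq
    · exact hr
  unfold height at hx'
  apply plane_ext
  · simp
  · simp; linarith

lemma collinear_of_fst_eq {p q r : Plane} (hq : q 0 = p 0) (hr : r 0 = p 0) :
    Collinear ℝ {p, q, r} := by
  rw [collinear_iff_exists_forall_eq_smul_vadd]
  refine ⟨p, !₂[0, 1], fun x hx => ⟨x 1 - p 1, ?_⟩⟩
  have hx' : x 0 = p 0 := by
    rcases hx with rfl | rfl | rfl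
    · rfl
    · exact hq
    · exact hr
  apply plane_ext
  · simp [hx']
  · simp

lemma eq_or_eq_of_height_eq {S : Set Plane} (hS : InGeneralPosition S) {s : ℝ} {p q r : Plane}
    (hp : p ∈ S) (hq : q ∈ S) (hr : r ∈ S) (hpq : p ≠ q)
    (h1 : height s q = height s p) (h2 : height s r = height s p) : r = p ∨ r = q := by
  by_contra! hne
  exact hS p hp q hq r hr hpq hne.1.symm hne.2.symm (collinear_of_height_eq h1 h2)

/-- The apex `q` is strictly below the line carrying the ray of `p`, and a slope of at most `σ p`
never brings the ray of `q` back up to that line. -/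
lemma disjoint_rays_of_isAbove {σ : Plane → ℝ} {p q : Plane} (h : IsAbove σ p q) :
    Disjoint (ray p !₂[1, σ p]) (ray q !₂[1, σ q]) := by
  rw [Set.disjoint_left]
  rintro x ⟨t, ht, rfl⟩ ⟨u, hu, he⟩
  have e0 := congrArg (fun z : Plane => z 0) he
  have e1 := congrArg (fun z : Plane => z 1) he
  simp at e0 e1
  obtain ⟨h1, h2⟩ := h
  unfold height at h2
  have e2 := congrArg (σ p * ·) e0
  linarith [mul_nonneg hu (sub_nonneg.2 h1), mul_add (σ p) (p 0) t, mul_add (σ p) (q 0) u,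
    mul_sub u (σ p) (σ q), mul_comm t (σ p), mul_comm u (σ p)]

/-! ### Order of the rays on large circles -/

/-- The abscissa of the far intersection of the line of slope `s` and height `h` with the circle
of radius `ρ` around the origin. -/
noncomputable def farAbscissa (s h ρ : ℝ) : ℝ :=
  (√((1 + s ^ 2) * ρ ^ 2 - h ^ 2) - h * s) / (1 + s ^ 2)

lemma tendsto_farAbscissa_div (s h : ℝ) :
    Tendsto (fun ρ => farAbscissa s h ρ / ρ) atTop (𝓝 (1 / √(1 + s ^ 2))) := by
  have hinv : Tendsto (fun ρ : ℝ => ρ⁻¹) atTop (𝓝 0) := tendsto_inv_atTop_zero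
  have ha : 0 < 1 + s ^ 2 := by positivity
  have key : Tendsto (fun ρ : ℝ => (√((1 + s ^ 2) - h ^ 2 * ρ⁻¹ ^ 2) - h * s * ρ⁻¹) / (1 + s ^ 2))
      atTop (𝓝 ((√((1 + s ^ 2) - h ^ 2 * 0 ^ 2) - h * s * 0) / (1 + s ^ 2))) := by
    apply Tendsto.div_const
    apply Tendsto.sub
    · exact (tendsto_const_nhds.sub ((hinv.pow 2).const_mul _)).sqrt
    · exact hinv.const_mul _
  have e : (√((1 + s ^ 2) - h ^ 2 * 0 ^ 2) - h * s * 0) / (1 + s ^ 2) = 1 / √(1 + s ^ 2) := by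
    simp only [ne_eq, OfNat.ofNat_ne_zero, not_false_eq_true, zero_pow, mul_zero, sub_zero]
    rw [div_eq_div_iff ha.ne' (by positivity), one_mul, Real.mul_self_sqrt ha.le]
  rw [e] at key
  refine key.congr' ?_
  filter_upwards [eventually_gt_atTop 0] with ρ hρ
  have : √((1 + s ^ 2) * ρ ^ 2 - h ^ 2) = ρ * √((1 + s ^ 2) - h ^ 2 * ρ⁻¹ ^ 2) := by
    rw [← Real.sqrt_sq hρ.le, ← Real.sqrt_mul (sq_nonneg _), Real.sqrt_sq hρ.le]
    congr 1
    field_simp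
  unfold farAbscissa
  rw [this]
  field_simp

lemma tendsto_farAbscissa (s h : ℝ) : Tendsto (farAbscissa s h) atTop atTop := by
  have h1 := (tendsto_farAbscissa_div s h).pos_mul_atTop (by positivity) tendsto_id
  refine h1.congr' ?_
  filter_upwards [eventually_gt_atTop 0] with ρ hρ
  simp only [id]
  field_simp

lemma farAbscissa_sq {s h ρ : ℝ} (hρ : h ^ 2 ≤ (1 + s ^ 2) * ρ ^ 2) :
    farAbscissa s h ρ ^ 2 + (h + s * farAbscissa s h ρ) ^ 2 = ρ ^ 2 := by
  have ha : 0 < 1 + s ^ 2 := by positivity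
  have h1 := Real.sq_sqrt (sub_nonneg.2 hρ)
  unfold farAbscissa
  set w := √((1 + s ^ 2) * ρ ^ 2 - h ^ 2)
  field_simp
  linear_combination (1 + s ^ 2) * h1

/-- The polar angle of the far intersection of the right-going ray of slope `s` from `p` with the
circle of radius `ρ` around the origin. -/
noncomputable def farAngle (s : ℝ) (p : Plane) (ρ : ℝ) : ℝ :=
  Real.arctan (s + height s p / farAbscissa s (height s p) ρ)

lemma eventually_circlePoint_farAngle_mem (s : ℝ) (p : Plane) :
    ∀ᶠ ρ in atTop, circlePoint ρ (farAngle s p ρ) ∈ ray p !₂[1, s] := by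
  filter_upwards [(tendsto_farAbscissa s (height s p)).eventually_gt_atTop 0,
    (tendsto_farAbscissa s (height s p)).eventually_ge_atTop (p 0),
    eventually_gt_atTop 0, eventually_ge_atTop |height s p|] with ρ h1 h2 h3 h4
  have h5 : height s p ^ 2 ≤ (1 + s ^ 2) * ρ ^ 2 := by
    have : height s p ^ 2 ≤ ρ ^ 2 := sq_le_sq' (by linarith [neg_abs_le (height s p)])
      (le_trans (le_abs_self _) h4)
    nlinarith [mul_nonneg (sq_nonneg s) (sq_nonneg ρ)]
  have h6 := farAbscissa_sq h5
  unfold farAngle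
  set h := height s p with hh
  set X := farAbscissa s h ρ
  have h7 : √(1 + (s + h / X) ^ 2) = ρ / X := by
    rw [← Real.sqrt_sq (div_pos h3 h1).le, div_pow, ← h6]
    congr 1
    field_simp
    ring
  -- The direction has abscissa 1, so the ray parameter is the difference of abscissas; it is
  -- nonnegative once the far intersection has passed the apex.
  refine ⟨X - p 0, sub_nonneg.2 h2, ?_⟩
  unfold circlePoint
  unfold height at hh
  apply plane_ext
  · simp [Real.cos_arctan, h7]
    field_simp
  · simp [Real.sin_arctan, h7]
    field_simp
    linear_combination hh

/-- The tangent of the polar angle is the slope plus height / abscissa, and the second term tends to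
0, so different slopes decide the order. For equal slopes that term is rescaled by ρ, and the
heights decide. -/
lemma eventually_farAngle_lt {σ : Plane → ℝ} {p q : Plane} (h : IsAbove σ p q) :
    ∀ᶠ ρ in atTop, farAngle (σ q) q ρ < farAngle (σ p) p ρ := by
  have lim (s h : ℝ) : Tendsto (fun ρ => ρ * (h / farAbscissa s h ρ)) atTop
      (𝓝 (h * √(1 + s ^ 2))) := by
    have := ((tendsto_farAbscissa_div s h).inv₀ (by positivity)).const_mul h
    refine (this.congr' ?_).trans (by simp)
    filter_upwards with ρ
    rw [inv_div]; ring
  suffices hs : ∀ᶠ ρ in atTop, σ q + height (σ q) q / farAbscissa (σ q) (height (σ q) q) ρ <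
      σ p + height (σ p) p / farAbscissa (σ p) (height (σ p) p) ρ by
    filter_upwards [hs] with ρ hρ
    exact Real.arctan_strictMono hρ
  obtain ⟨h1, h2⟩ := h
  rcases h1.lt_or_eq with h1 | h1
  · have l0 (s h : ℝ) : Tendsto (fun ρ => s + h / farAbscissa s h ρ) atTop (𝓝 s) := by
      simpa using ((tendsto_farAbscissa s h).const_div_atTop h).const_add s
    exact (l0 _ _).eventually_lt (l0 _ _) h1
  · rw [h1]
    have h3 : height (σ p) q * √(1 + σ p ^ 2) < height (σ p) p * √(1 + σ p ^ 2) :=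
      mul_lt_mul_of_pos_right h2 (by positivity)
    filter_upwards [(lim (σ p) (height (σ p) q)).eventually_lt (lim (σ p) (height (σ p) p)) h3,
      eventually_gt_atTop 0] with ρ h4 h5
    have := lt_of_mul_lt_mul_left h4 h5.le
    linarith

lemma farAngle_lt_pi_div_two (s : ℝ) (p : Plane) (ρ : ℝ) : farAngle s p ρ < Real.pi / 2 :=
  Real.arctan_lt_pi_div_two _

lemma neg_pi_div_two_lt_farAngle (s : ℝ) (p : Plane) (ρ : ℝ) : -(Real.pi / 2) < farAngle s p ρ :=
  Real.neg_pi_div_two_lt_arctan _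

lemma eventually_pairwise_farAngle {σ : Plane → ℝ} {L : List Plane} (hL : L.Pairwise (IsAbove σ)) :
    ∀ᶠ ρ in atTop, (∀ p ∈ L, circlePoint ρ (farAngle (σ p) p ρ) ∈ ray p !₂[1, σ p]) ∧
      L.Pairwise fun p q => farAngle (σ q) q ρ < farAngle (σ p) p ρ := by
  induction hL with
  | nil => simp
  | @cons p L hp hL ih =>
    have h1 : ∀ᶠ ρ in atTop, ∀ q ∈ L, farAngle (σ q) q ρ < farAngle (σ p) p ρ := by
      have := (L.finite_toSet.eventually_all (l := atTop)
        (p := fun (q : Plane) (ρ : ℝ) => farAngle (σ q) q ρ < farAngle (σ p) p ρ)).2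
        fun q hq => eventually_farAngle_lt (hp q hq)
      simpa using this
    filter_upwards [ih, h1, eventually_circlePoint_farAngle_mem (σ p) p] with ρ h2 h3 h4
    exact ⟨by simpa using ⟨h4, h2.1⟩, List.pairwise_cons.2 ⟨h3, h2.2⟩⟩

lemma right_ne_zero (s : ℝ) : (!₂[1, s] : Plane) ≠ 0 := fun h => by
  simpa using congrArg (fun z : Plane => z 0) h

lemma nodup_of_pairwise_height {s : ℝ} {L : List Plane}
    (h : L.Pairwise fun p q => height s q < height s p) : L.Nodup :=
  h.imp fun hpq => by rintro rfl; exact lt_irrefl _ hpq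

lemma nodup_of_pairwise_isAbove {σ : Plane → ℝ} {L : List Plane} (h : L.Pairwise (IsAbove σ)) :
    L.Nodup :=
  h.imp fun hpq => by rintro rfl; exact lt_irrefl _ hpq.2

/-- Right-going rays whose slopes and heights decrease along `L` give a feasible configuration. -/
lemma isFeasible_of_pairwise_isAbove {R B : Finset Plane} {σ : Plane → ℝ} {L : List Plane}
    (hmem : ∀ p, p ∈ L ↔ p ∈ R ∨ p ∈ B) (h : L.Pairwise (IsAbove σ)) :
    IsFeasible R B (L.map (pointColor R) : Cycle RayColor) := by
  refine ⟨fun p => !₂[1, σ p], ⟨fun p _ => right_ne_zero _, ?_⟩, L, nodup_of_pairwise_isAbove h,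
    hmem, ?_, rfl⟩
  · have h2 : L.Pairwise fun p q => Disjoint (ray p !₂[1, σ p]) (ray q !₂[1, σ q]) :=
      h.imp disjoint_rays_of_isAbove
    intro p hp q hq hpq
    have : Std.Symm fun p q : Plane => Disjoint (ray p !₂[1, σ p]) (ray q !₂[1, σ q]) :=
      ⟨fun _ _ hd => Disjoint.symm hd⟩
    exact h2.forall ((hmem p).2 (by simpa using hp)) ((hmem q).2 (by simpa using hq)) hpq
  · filter_upwards [eventually_pairwise_farAngle h] with ρ hρ
    refine ⟨fun p => farAngle (σ p) p ρ, hρ.1, hρ.2.imp fun {p q} hpq => ⟨hpq, ?_⟩⟩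
    linarith [farAngle_lt_pi_div_two (σ p) p ρ, neg_pi_div_two_lt_farAngle (σ q) q ρ, Real.pi_pos]

lemma height_neg (s : ℝ) (p : Plane) : height s (-p) = -height s p := by
  simp [height]; ring

lemma circlePoint_sub_pi (ρ θ : ℝ) : circlePoint ρ (θ - Real.pi) = -circlePoint ρ θ := by
  apply plane_ext <;> simp [circlePoint, Real.cos_sub_pi, Real.sin_sub_pi]

lemma mem_ray_neg {p v x : Plane} : -x ∈ ray p (-v) ↔ x ∈ ray (-p) v := by
  constructor
  · rintro ⟨t, ht, hx⟩
    refine ⟨t, ht, ?_⟩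
    rw [← neg_neg x, hx, smul_neg, neg_add, neg_neg]
  · rintro ⟨t, ht, rfl⟩
    exact ⟨t, ht, by rw [smul_neg, neg_add, neg_neg]⟩

lemma height_eq_of_mem_ray {s : ℝ} {p x v : Plane} (hv : v = !₂[1, s] ∨ v = -!₂[1, s])
    (hx : x ∈ ray p v) : height s x = height s p := by
  obtain ⟨t, -, rfl⟩ := hx
  rcases hv with rfl | rfl <;> simp [height] <;> ring

/-- Parallel rays on different lines, those from `L₁` going to the right and those from `L₂` going
to the left, give a feasible configuration. -/
lemma isFeasible_of_parallel {R B : Finset Plane} {s : ℝ} {L₁ L₂ : List Plane}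
    (hmem : ∀ p, p ∈ L₁ ++ L₂ ↔ p ∈ R ∨ p ∈ B) (hnd : (L₁ ++ L₂).Nodup)
    (hinj : ∀ p ∈ L₁ ++ L₂, ∀ q ∈ L₁ ++ L₂, height s p = height s q → p = q)
    (h₁ : L₁.Pairwise fun p q => height s q < height s p)
    (h₂ : L₂.Pairwise fun p q => height s p < height s q) :
    IsFeasible R B ((L₁ ++ L₂).map (pointColor R) : Cycle RayColor) := by
  classical
  have hdis := (List.nodup_append.1 hnd).2.2
  have hR : ∀ p ∈ L₂, p ∉ L₁ := fun p h2 h1 => hdis p h1 p h2 rfl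
  let v : Plane → Plane := fun p => if p ∈ L₁ then !₂[1, s] else -!₂[1, s]
  have hv : ∀ p, v p = !₂[1, s] ∨ v p = -!₂[1, s] := fun p => by
    by_cases hp : p ∈ L₁ <;> simp [v, hp]
  refine ⟨v, ⟨fun p _ => ?_, ?_⟩, L₁ ++ L₂, hnd, hmem, ?_, rfl⟩
  · rcases hv p with h | h <;> rw [h]
    · exact right_ne_zero s
    · exact neg_ne_zero.2 (right_ne_zero s)
  · intro p hp q hq hpq
    rw [Set.disjoint_left]
    intro x hxp hxq
    exact hpq (hinj p ((hmem p).2 (by simpa using hp)) q ((hmem q).2 (by simpa using hq))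
      ((height_eq_of_mem_ray (hv p) hxp).symm.trans (height_eq_of_mem_ray (hv q) hxq)))
  · have e₁ := eventually_pairwise_farAngle (σ := fun _ => s) (L := L₁)
      (h₁.imp fun h => ⟨le_rfl, h⟩)
    -- The half-turn p ↦ -p makes the left-going rays right-going. Subtracting π from their angles
    -- places them after all the right-going ones, with everything inside (-3π/2, π/2).
    have e₂ := eventually_pairwise_farAngle (σ := fun _ => s) (L := L₂.map (fun p => -p)) (by
      rw [List.pairwise_map]
      exact h₂.imp fun h => ⟨le_rfl, by rw [height_neg, height_neg]; exact neg_lt_neg h⟩)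
    filter_upwards [e₁, e₂] with ρ ⟨m₁, k₁⟩ ⟨m₂, k₂⟩
    rw [List.pairwise_map] at k₂
    have b := fun p => farAngle_lt_pi_div_two s p ρ
    have b' := fun p => neg_pi_div_two_lt_farAngle s p ρ
    refine ⟨fun p => if p ∈ L₁ then farAngle s p ρ else farAngle s (-p) ρ - Real.pi, ?_, ?_⟩
    · intro p hp
      by_cases hp1 : p ∈ L₁
      · simpa [v, hp1] using m₁ p hp1
      · have hp2 : p ∈ L₂ := by simpa [hp1] using hp
        have := m₂ (-p) (List.mem_map_of_mem hp2)
        simp only [v, if_neg hp1]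
        rw [circlePoint_sub_pi]
        exact mem_ray_neg.2 this
    · rw [List.pairwise_append]
      refine ⟨k₁.imp_of_mem fun {p q} hp hq h => ?_, k₂.imp_of_mem fun {p q} hp hq h => ?_,
        fun p hp q hq => ?_⟩
      · simp only [if_pos hp, if_pos hq]
        exact ⟨h, by linarith [b p, b' q, Real.pi_pos]⟩
      · simp only [if_neg (hR p hp), if_neg (hR q hq)]
        exact ⟨by linarith, by linarith [b (-p), b' (-q), Real.pi_pos]⟩
      · simp only [if_pos hp, if_neg (hR q hq)]
        exact ⟨by linarith [b' p, b (-q)], by linarith [b p, b' (-q)]⟩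

/-! ### Words versus circular sequences -/

lemma exists_sorted (s : ℝ) (F : Finset Plane)
    (hinj : ∀ p ∈ F, ∀ q ∈ F, height s p = height s q → p = q) :
    ∃ L : List Plane, (∀ p, p ∈ L ↔ p ∈ F) ∧ L.Pairwise fun p q => height s q < height s p := by
  classical
  induction F using Finset.induction_on_max_value (height s) with
  | empty => exact ⟨[], by simp, List.Pairwise.nil⟩
  | insert a F ha hmax ih =>
    obtain ⟨L, h1, h2⟩ := ih fun p hp q hq =>
      hinj p (Finset.mem_insert_of_mem hp) q (Finset.mem_insert_of_mem hq)
    refine ⟨a :: L, fun p => by simp [h1], List.pairwise_cons.2 ⟨fun q hq => ?_, h2⟩⟩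
    have hq' := (h1 q).1 hq
    refine (hmax q hq').lt_of_ne fun he => ha ?_
    rw [← hinj q (Finset.mem_insert_of_mem hq') a (Finset.mem_insert_self _ _) he]
    exact hq'

lemma length_eq_card {L : List Plane} {F : Finset Plane} (hnd : L.Nodup)
    (h : ∀ p, p ∈ L ↔ p ∈ F) : L.length = F.card := by
  classical
  rw [← List.toFinset_card_of_nodup hnd]
  congr 1
  ext p
  simp [h]

instance : Finite RayColor :=
  Finite.of_injective (fun c : RayColor => match c with | .red => true | .blue => false)
    (by rintro (_ | _) (_ | _) <;> simp)

lemma finite_setOf_isFeasible (R B : Finset Plane) :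
    {C : Cycle RayColor | IsFeasible R B C}.Finite := by
  classical
  refine ((List.finite_length_eq RayColor (R ∪ B).card).image
    (fun l : List RayColor => (l : Cycle RayColor))).subset ?_
  rintro C ⟨v, -, L, hnd, hmem, -, rfl⟩
  exact ⟨_, by simpa using length_eq_card hnd (F := R ∪ B) (by simpa using hmem), rfl⟩

/-- Every circular sequence of length `N` comes from at most `N` words. -/
lemma card_le_mul_gammaCount {R B : Finset Plane} {N : ℕ} (hN : 0 < N)
    (F : Finset (List RayColor))
    (hF : ∀ w ∈ F, w.length = N ∧ IsFeasible R B (w : Cycle RayColor)) :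
    F.card ≤ N * gammaCount R B := by
  classical
  have h1 : F.card ≤ N * (F.image fun w : List RayColor => (w : Cycle RayColor)).card := by
    apply Finset.card_le_mul_card_image
    intro C hC
    obtain ⟨w, hw, rfl⟩ := Finset.mem_image.1 hC
    have hlen := (hF w hw).1
    have hne : w ≠ [] := by rintro rfl; simp at hlen; omega
    -- The words with the same circular sequence as `w` are its rotations.
    calc _ ≤ w.cyclicPermutations.toFinset.card := by
            apply Finset.card_le_card
            intro u hu
            rw [Finset.mem_filter] at hu
            rw [List.mem_toFinset, List.mem_cyclicPermutations_iff]
            exact Cycle.coe_eq_coe.1 hu.2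
      _ ≤ w.cyclicPermutations.length := List.toFinset_card_le _
      _ = N := by rw [List.length_cyclicPermutations_of_ne_nil _ hne, hlen]
  refine h1.trans (Nat.mul_le_mul_left _ ?_)
  rw [← Set.ncard_coe_finset]
  refine Set.ncard_le_ncard ?_ (finite_setOf_isFeasible R B)
  intro C hC
  obtain ⟨w, hw, rfl⟩ := Finset.mem_image.1 (Finset.mem_coe.1 hC)
  exact (hF w hw).2

/-! ### Reflection in the vertical axis -/

/-- The reflection in the vertical axis. -/
noncomputable def mirror : Plane ≃ Plane where
  toFun p := !₂[-p 0, p 1]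
  invFun p := !₂[-p 0, p 1]
  left_inv p := by apply plane_ext <;> simp
  right_inv p := by apply plane_ext <;> simp

@[simp] lemma mirror_zero (p : Plane) : mirror p 0 = -p 0 := rfl
@[simp] lemma mirror_one (p : Plane) : mirror p 1 = p 1 := rfl
@[simp] lemma mirror_symm : mirror.symm = mirror := rfl

@[simp] lemma mirror_mirror (p : Plane) : mirror (mirror p) = p := mirror.left_inv p

lemma mem_map_mirror {R : Finset Plane} {p : Plane} :
    p ∈ R.map mirror.toEmbedding ↔ mirror p ∈ R := by
  rw [Finset.mem_map_equiv, mirror_symm]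

lemma pointColor_mirror (R : Finset Plane) (p : Plane) :
    pointColor (R.map mirror.toEmbedding) p = pointColor R (mirror p) := by
  simp only [pointColor, mem_map_mirror]

lemma mem_ray_mirror {p v x : Plane} : x ∈ ray (mirror p) v ↔ mirror x ∈ ray p (mirror v) := by
  have key : ∀ {p v x : Plane}, x ∈ ray (mirror p) v → mirror x ∈ ray p (mirror v) := by
    rintro p v x ⟨t, ht, rfl⟩
    refine ⟨t, ht, ?_⟩
    apply plane_ext
    · simp; ring
    · simp
  refine ⟨key, fun h => ?_⟩
  have h' := key (p := mirror p) (v := mirror v) (x := mirror x) (by simpa only [mirror_mirror] using h)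
  simpa only [mirror_mirror] using h'

lemma circlePoint_pi_sub (ρ θ : ℝ) : circlePoint ρ (Real.pi - θ) = mirror (circlePoint ρ θ) := by
  apply plane_ext <;> simp [circlePoint]

/-- Reflection turns the polar angle θ into π - θ, so clockwise order becomes counterclockwise and
the sequence is read backwards. -/
lemma isFeasible_reverse_of_mirror {R B : Finset Plane} {C : Cycle RayColor}
    (h : IsFeasible (R.map mirror.toEmbedding) (B.map mirror.toEmbedding) C) :
    IsFeasible R B C.reverse := by
  obtain ⟨v, ⟨hv0, hv⟩, L, hnd, hmem, hord, rfl⟩ := h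
  have memS : ∀ p ∈ (R : Set Plane) ∪ B, mirror p ∈
      (R.map mirror.toEmbedding : Set Plane) ∪ (B.map mirror.toEmbedding : Set Plane) := by
    intro p hp
    rw [Set.mem_union, Finset.mem_coe, Finset.mem_coe, mem_map_mirror, mem_map_mirror,
      mirror_mirror]
    exact hp
  refine ⟨fun p => mirror (v (mirror p)), ⟨fun p hp h0 => hv0 _ (memS p hp) ?_, ?_⟩,
    (L.map mirror).reverse, ?_, fun p => ?_, ?_, ?_⟩
  · rw [← mirror_mirror (v _), show mirror (v (mirror p)) = 0 from h0]
    apply plane_ext <;> simp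
  · intro p hp q hq hpq
    have := hv (memS p hp) (memS q hq) (mirror.injective.ne hpq)
    simp only [Set.disjoint_left] at this ⊢
    intro x hx hx'
    refine this (a := mirror x) ?_ ?_
    · rw [mem_ray_mirror, mirror_mirror]; exact hx
    · rw [mem_ray_mirror, mirror_mirror]; exact hx'
  · rw [List.nodup_reverse]
    exact hnd.map mirror.injective
  · have : p ∈ (L.map mirror).reverse ↔ mirror p ∈ L := by
      rw [List.mem_reverse, List.mem_map]
      exact ⟨by rintro ⟨q, hq, rfl⟩; simpa using hq, fun h => ⟨_, h, mirror_mirror p⟩⟩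
    rw [this, hmem, mem_map_mirror, mem_map_mirror, mirror_mirror]
  · filter_upwards [hord] with ρ ⟨θ, h1, h2⟩
    refine ⟨fun p => Real.pi - θ (mirror p), ?_, ?_⟩
    · intro p hp
      rw [List.mem_reverse, List.mem_map] at hp
      obtain ⟨q, hq, rfl⟩ := hp
      rw [circlePoint_pi_sub, mirror_mirror, mem_ray_mirror, mirror_mirror, mirror_mirror]
      exact h1 q hq
    · rw [List.pairwise_reverse, List.pairwise_map]
      refine h2.imp fun {p q} h => ?_
      simp only [mirror_mirror]
      exact ⟨by linarith, by linarith⟩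
  · rw [Cycle.reverse_coe, List.map_reverse, List.map_map]
    congr 2
    exact List.map_congr_left fun p _ => pointColor_mirror R p

lemma gammaCount_mirror_le (R B : Finset Plane) :
    gammaCount (R.map mirror.toEmbedding) (B.map mirror.toEmbedding) ≤ gammaCount R B := by
  refine Set.ncard_le_ncard_of_injOn Cycle.reverse (fun C hC => isFeasible_reverse_of_mirror hC)
    ?_ (finite_setOf_isFeasible R B)
  intro C _ D _ h
  rw [← Cycle.reverse_reverse C, h, Cycle.reverse_reverse]

lemma inGeneralPosition_mirror {R B : Finset Plane}
    (h : InGeneralPosition ((R : Set Plane) ∪ (B : Set Plane))) :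
    InGeneralPosition ((R.map mirror.toEmbedding : Set Plane) ∪
      (B.map mirror.toEmbedding : Set Plane)) := by
  have memS : ∀ p, p ∈ (R.map mirror.toEmbedding : Set Plane) ∪
      (B.map mirror.toEmbedding : Set Plane) → mirror p ∈ (R : Set Plane) ∪ B := by
    intro p hp
    rwa [Set.mem_union, Finset.mem_coe, Finset.mem_coe, mem_map_mirror, mem_map_mirror] at hp
  have key : ∀ p q r : Plane, Collinear ℝ {p, q, r} →
      Collinear ℝ {mirror p, mirror q, mirror r} := by
    intro p q r hc
    rw [collinear_iff_exists_forall_eq_smul_vadd] at hc ⊢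
    obtain ⟨a, v, hc⟩ := hc
    have hm : ∀ x, (∃ t : ℝ, x = t • v +ᵥ a) → ∃ t : ℝ, mirror x = t • mirror v +ᵥ mirror a := by
      rintro x ⟨t, rfl⟩
      refine ⟨t, ?_⟩
      apply plane_ext
      · simp; ring
      · simp
    refine ⟨mirror a, mirror v, ?_⟩
    rintro x (rfl | rfl | rfl)
    · exact hm _ (hc _ (by simp))
    · exact hm _ (hc _ (by simp))
    · exact hm _ (hc _ (by simp))
  intro p hp q hq r hr hpq hpr hqr hc
  exact h _ (memS p hp) _ (memS q hq) _ (memS r hr) (mirror.injective.ne hpq)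
    (mirror.injective.ne hpr) (mirror.injective.ne hqr) (key p q r hc)

/-! ### The stack of bichromatic pairs -/

/-- The slope of the line through a pair of points. -/
noncomputable def slope (x : Plane × Plane) : ℝ := (x.2 1 - x.1 1) / (x.2 0 - x.1 0)

/-- Both points of `y` lie strictly below the line through the pair `x`. -/
def LiesBelow (x y : Plane × Plane) : Prop :=
  height (slope x) y.1 < height (slope x) x.1 ∧ height (slope x) y.2 < height (slope x) x.1

lemma height_slope {x : Plane × Plane} (hx : x.1 0 ≠ x.2 0) :
    height (slope x) x.2 = height (slope x) x.1 := by
  have : x.2 0 - x.1 0 ≠ 0 := sub_ne_zero.2 hx.symm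
  unfold height slope
  field_simp
  ring

/-- Two nonempty finite sets separated by a vertical line have an upper common tangent. -/
lemma exists_bridge {A C : Finset Plane} {x₀ : ℝ} (hA : ∀ a ∈ A, a 0 < x₀) (hC : ∀ c ∈ C, x₀ < c 0)
    (neA : A.Nonempty) (neC : C.Nonempty) :
    ∃ a ∈ A, ∃ c ∈ C, (∀ p ∈ A, height (slope (a, c)) p ≤ height (slope (a, c)) a) ∧
      ∀ p ∈ C, height (slope (a, c)) p ≤ height (slope (a, c)) a := by
  -- The tangent is the segment that crosses the separating vertical line highest: a point above its
  -- line could replace the endpoint on the same side and raise the crossing.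
  obtain ⟨⟨a, c⟩, hac, hmax⟩ := (A ×ˢ C).exists_max_image
    (fun x => height (slope x) x.1 + slope x * x₀) (neA.product neC)
  rw [Finset.mem_product] at hac
  obtain ⟨ha, hc⟩ := hac
  have hac0 : a 0 < c 0 := (hA a ha).trans (hC c hc)
  have hs := height_slope (x := (a, c)) hac0.ne
  refine ⟨a, ha, c, hc, fun p hp => ?_, fun p hp => ?_⟩
  · by_contra! hlt
    have hpc0 : p 0 < c 0 := (hA p hp).trans (hC c hc)
    have h1 := hmax (p, c) (Finset.mem_product.2 ⟨hp, hc⟩)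
    have hs' := height_slope (x := (p, c)) hpc0.ne
    have h2 : slope (p, c) < slope (a, c) := by
      rw [slope, div_lt_iff₀ (sub_pos.2 hpc0)]
      simp only [height] at hlt hs ⊢
      linarith
    simp only [height] at h1 hs hs'
    nlinarith [mul_pos (sub_pos.2 h2) (sub_pos.2 (hC c hc))]
  · by_contra! hlt
    have hpc0 : a 0 < p 0 := (hA a ha).trans (hC p hp)
    have h1 := hmax (a, p) (Finset.mem_product.2 ⟨ha, hp⟩)
    have h2 : slope (a, c) < slope (a, p) := by
      conv_rhs => rw [slope]
      rw [lt_div_iff₀ (sub_pos.2 hpc0)]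
      simp only [height] at hlt hs ⊢
      linarith
    simp only [height] at h1
    nlinarith [mul_pos (sub_pos.2 h2) (sub_pos.2 (hA a ha))]

/-- Removing upper common tangents one after the other yields a list of pairs of points, all later
pairs lying below the line of each pair. -/
lemma exists_stack {x₀ : ℝ} (m : ℕ) (A C : Finset Plane) (hA : ∀ a ∈ A, a 0 < x₀)
    (hC : ∀ c ∈ C, x₀ < c 0) (hgp : InGeneralPosition ((A : Set Plane) ∪ (C : Set Plane)))
    (cA : m ≤ A.card) (cC : m ≤ C.card) :
    ∃ l : List (Plane × Plane), l.length = m ∧ (∀ x ∈ l, x.1 ∈ A ∧ x.2 ∈ C) ∧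
      l.Pairwise LiesBelow := by
  classical
  induction m generalizing A C with
  | zero => exact ⟨[], rfl, by simp, List.Pairwise.nil⟩
  | succ m ih =>
    obtain ⟨a, ha, c, hc, hA', hC'⟩ := exists_bridge hA hC (Finset.card_pos.1 (by omega))
      (Finset.card_pos.1 (by omega))
    have hne : a ≠ c := by
      rintro rfl
      exact lt_asymm (hA a ha) (hC a hc)
    have hs := height_slope (x := (a, c)) ((hA a ha).trans (hC c hc)).ne
    have strict : ∀ p, p ∈ A ∨ p ∈ C → p ≠ a → p ≠ c →
        height (slope (a, c)) p < height (slope (a, c)) a := by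
      intro p hp hpa hpc
      refine lt_of_le_of_ne (hp.elim (hA' p) (hC' p)) fun he => ?_
      rcases eq_or_eq_of_height_eq hgp (p := a) (q := c) (r := p) (by simp [ha]) (by simp [hc])
        (by simpa using hp) hne hs he with h | h
      · exact hpa h
      · exact hpc h
    obtain ⟨l, h1, h2, h3⟩ := ih (A.erase a) (C.erase c)
      (fun p hp => hA p (Finset.mem_of_mem_erase hp)) (fun p hp => hC p (Finset.mem_of_mem_erase hp))
      (fun p hp q hq r hr => hgp p (by simp at hp ⊢; tauto) q (by simp at hq ⊢; tauto) r
        (by simp at hr ⊢; tauto))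
      (by rw [Finset.card_erase_of_mem ha]; omega) (by rw [Finset.card_erase_of_mem hc]; omega)
    refine ⟨(a, c) :: l, by simp [h1], ?_, List.pairwise_cons.2 ⟨fun y hy => ?_, h3⟩⟩
    · intro x hx
      rcases List.mem_cons.1 hx with rfl | hx
      · exact ⟨ha, hc⟩
      · exact ⟨Finset.mem_of_mem_erase (h2 x hx).1, Finset.mem_of_mem_erase (h2 x hx).2⟩
    · obtain ⟨hy1, hy2⟩ := h2 y hy
      rw [Finset.mem_erase] at hy1 hy2
      refine ⟨strict _ (Or.inl hy1.2) hy1.1 ?_, strict _ (Or.inr hy2.2) ?_ hy2.1⟩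
      · intro h
        exact lt_asymm (hA _ hy1.2) (h ▸ hC c hc)
      · intro h
        exact lt_asymm (hC _ hy2.2) (h ▸ hA a ha)

/-! ### Counting strictly decreasing sublists -/

/-- The number of strictly decreasing sublists, positions being distinguished. -/
noncomputable def countDec : List ℝ → ℕ
  | [] => 1
  | s :: r => countDec r + countDec (r.filter (· < s))
termination_by l => l.length
decreasing_by
  · simp
  · simpa using Nat.lt_succ_of_le (List.length_filter_le (fun x => decide (x.1 < s)) r.attach)

lemma countDec_nil : countDec [] = 1 := by rw [countDec]

lemma countDec_cons (s : ℝ) (r : List ℝ) :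
    countDec (s :: r) = countDec r + countDec (r.filter (· < s)) := by rw [countDec]

lemma countDec_of_pairwise_gt {l : List ℝ} (h : l.Pairwise (· > ·)) :
    countDec l = 2 ^ l.length := by
  induction h with
  | nil => simp [countDec_nil]
  | @cons s r hs _ ih =>
    rw [countDec_cons, List.filter_eq_self.2 (by simpa using hs), ih, List.length_cons, pow_succ]
    ring

/-- A strictly decreasing sublist uses no copy of the upper bound `s` or exactly one of its copies,
and the remaining choice is independent of this because all copies come first. -/
lemma countDec_eq_mul {s : ℝ} {l : List ℝ} (h : l.Pairwise (· ≥ ·)) (hs : ∀ t ∈ l, t ≤ s) :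
    countDec l = (l.count s + 1) * countDec (l.filter (· < s)) := by
  induction h with
  | nil => simp
  | @cons t r ht _ ih =>
    rcases (hs t (by simp)).lt_or_eq with hts | rfl
    · have hlt : ∀ u ∈ t :: r, u < s := by
        intro u hu
        rcases List.mem_cons.1 hu with rfl | hu
        · exact hts
        · exact (ht u hu).trans_lt hts
      rw [List.filter_eq_self.2 (by simpa using hlt),
        List.count_eq_zero.2 fun hm => lt_irrefl _ (hlt _ hm)]
      simp
    · rw [countDec_cons, ih fun u hu => hs u (List.mem_cons_of_mem _ hu), List.count_cons_self,
        List.filter_cons_of_neg (by simp)]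
      ring

lemma length_eq_count_add {s : ℝ} {l : List ℝ} (hs : ∀ t ∈ l, t ≤ s) :
    l.length = l.count s + (l.filter (· < s)).length := by
  induction l with
  | nil => simp
  | cons t r ih =>
    have ih := ih fun u hu => hs u (List.mem_cons_of_mem _ hu)
    rcases (hs t (by simp)).lt_or_eq with hts | rfl
    · rw [List.count_cons_of_ne hts.ne, List.filter_cons_of_pos (by simpa using hts)]
      simp only [List.length_cons]
      omega
    · rw [List.count_cons_self, List.filter_cons_of_neg (by simp)]
      simp only [List.length_cons]
      omega

/-- A class of `g` equal slopes contributes the factor g + 1 to `countDec`; this says that the k-th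
power of the factor is worth at least 4 per element. The case g = 2 is what forces 3 ≤ k. -/
lemma four_pow_le {g k : ℕ} (hk : 3 ≤ k) (hg : g ≤ k) : 4 ^ g ≤ (g + 1) ^ k := by
  rcases lt_or_ge g 3 with h | h
  · have mono : (g + 1) ^ 3 ≤ (g + 1) ^ k := Nat.pow_le_pow_right (by omega) hk
    interval_cases g <;> omega
  · exact (Nat.pow_le_pow_right (by norm_num) hg).trans (Nat.pow_le_pow_left (by omega) k)

/-- For a weakly decreasing list, `countDec` is the product of multiplicity + 1 over the distinct
values; the induction peels off the class of the largest value. -/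
lemma four_pow_length_le {k : ℕ} (hk : 3 ≤ k) (l : List ℝ) (h : l.Pairwise (· ≥ ·))
    (hc : ∀ s, l.count s ≤ k) : 4 ^ l.length ≤ countDec l ^ k := by
  induction hn : l.length using Nat.strong_induction_on generalizing l with
  | _ n ih =>
    cases l with
    | nil => simp at hn; subst hn; simp [countDec_nil]
    | cons s r =>
      have hs : ∀ t ∈ s :: r, t ≤ s := by
        intro t ht
        rcases List.mem_cons.1 ht with rfl | ht
        · exact le_rfl
        · exact List.rel_of_pairwise_cons h ht
      have hlen := length_eq_count_add hs
      have hpos : 0 < (s :: r).count s := by simp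
      have := ih _ (by omega) ((s :: r).filter (· < s)) (h.filter _)
        (fun t => (List.filter_sublist.count_le t).trans (hc t)) rfl
      rw [countDec_eq_mul h hs, mul_pow, ← hn, hlen, pow_add]
      exact Nat.mul_le_mul (four_pow_le hk (hc s)) this

/-! ### The Erdős–Szekeres argument -/

/-- Every element `x` gets the label `i` such that `x` starts a strictly increasing sublist of
length `i + 1`; elements with equal labels decrease weakly. -/
lemma exists_labels {α : Type*} (f : α → ℝ) (l : List α) :
    ∃ l' : List (α × ℕ), l'.map Prod.fst = l ∧
      (∀ x ∈ l', ∃ r : List α, (x.1 :: r).Sublist l ∧ r.length = x.2 ∧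
        (x.1 :: r).Pairwise fun a b => f a < f b) ∧
      l'.Pairwise fun x y => x.2 = y.2 → f y.1 ≤ f x.1 := by
  classical
  induction l with
  | nil => exact ⟨[], by simp⟩
  | cons a l ih =>
    obtain ⟨l', h1, h2, h3⟩ := ih
    let T : Finset ℕ := ((l'.filter fun y => f a < f y.1).map Prod.snd).toFinset
    have hT : ∀ j, j ∈ T ↔ ∃ y ∈ l', f a < f y.1 ∧ y.2 = j := fun j => by
      simp [T]
    -- One more than the largest label among later elements with a larger value. The empty supremum
    -- is 0, the right label when there are none.
    let i := T.sup (· + 1)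
    refine ⟨(a, i) :: l', by simp [h1], ?_, List.pairwise_cons.2 ⟨?_, h3⟩⟩
    · intro x hx
      rcases List.mem_cons.1 hx with rfl | hx
      · rcases T.eq_empty_or_nonempty with hT0 | hT0
        · exact ⟨[], by simp, by simp [i, hT0], by simp⟩
        · obtain ⟨j, hj, hji⟩ := Finset.exists_mem_eq_sup T hT0 (· + 1)
          obtain ⟨y, hy, hay, rfl⟩ := (hT j).1 hj
          obtain ⟨r, hr1, hr2, hr3⟩ := h2 y hy
          refine ⟨y.1 :: r, hr1.cons_cons a, by simpa [hr2] using hji.symm,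
            List.pairwise_cons.2 ⟨fun b hb => ?_, hr3⟩⟩
          rcases List.mem_cons.1 hb with rfl | hb
          · exact hay
          · exact hay.trans (List.rel_of_pairwise_cons hr3 hb)
      · obtain ⟨r, hr1, hr2⟩ := h2 x hx
        exact ⟨r, hr1.cons a, hr2⟩
    · intro y hy hiy
      by_contra! hlt
      have : y.2 + 1 ≤ i := Finset.le_sup (f := (· + 1)) ((hT _).2 ⟨y, hy, hlt, rfl⟩)
      simp only at hiy
      omega

lemma length_eq_sum_filter {α : Type*} (k : ℕ) (l : List (α × ℕ)) (h : ∀ x ∈ l, x.2 < k) :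
    l.length = ∑ i ∈ Finset.range k, (l.filter fun x => x.2 = i).length := by
  induction l with
  | nil => simp
  | cons x l ih =>
    have hx := h x (by simp)
    rw [List.length_cons, ih fun y hy => h y (List.mem_cons_of_mem _ hy)]
    have : ∀ i, ((x :: l).filter fun x => x.2 = i).length =
        (l.filter fun x => x.2 = i).length + if x.2 = i then 1 else 0 := by
      intro i
      by_cases hi : x.2 = i <;> simp [hi]
    simp only [this, Finset.sum_add_distrib, Finset.sum_ite_eq, Finset.mem_range, hx, if_true]

/-- A variant of the Erdős–Szekeres theorem: a long list has a strictly increasing sublist of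
length `k + 1`, or many equal elements, or a weakly decreasing sublist with many strictly
decreasing sublists. -/
lemma exists_sublist_trichotomy {α : Type*} (f : α → ℝ) (l : List α) {k : ℕ} (hk : 3 ≤ k)
    (hl : (k + 1) * k ^ 2 ≤ 2 * l.length) :
    (∃ l' : List α, l'.Sublist l ∧ l'.length = k + 1 ∧ l'.Pairwise fun a b => f a < f b) ∨
    (∃ l' : List α, l'.Sublist l ∧ l'.length = k + 1 ∧ ∃ s, ∀ a ∈ l', f a = s) ∨
    (∃ l' : List α, l'.Sublist l ∧ (l'.map f).Pairwise (· ≥ ·) ∧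
      2 ^ (k + 1) ≤ countDec (l'.map f)) := by
  classical
  obtain ⟨L, h1, h2, h3⟩ := exists_labels f l
  by_cases hlab : ∃ x ∈ L, k ≤ x.2
  · left
    obtain ⟨x, hx, hkx⟩ := hlab
    obtain ⟨r, hr1, hr2, hr3⟩ := h2 x hx
    refine ⟨(x.1 :: r).take (k + 1), (List.take_sublist _ _).trans hr1, ?_,
      hr3.sublist (List.take_sublist _ _)⟩
    rw [List.length_take, List.length_cons]
    omega
  · right
    push Not at hlab
    have hlen : L.length = l.length := by rw [← h1, List.length_map]
    have hsum := length_eq_sum_filter k L hlab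
    -- Pigeonhole over the k possible labels.
    obtain ⟨i, -, hi⟩ : ∃ i ∈ Finset.range k, (k + 1) * k ≤ 2 * (L.filter fun x => x.2 = i).length := by
      by_contra! hcon
      have : ∑ i ∈ Finset.range k, 2 * (L.filter fun x => x.2 = i).length <
          ∑ i ∈ Finset.range k, (k + 1) * k :=
        Finset.sum_lt_sum_of_nonempty (Finset.nonempty_range_iff.2 (by omega)) hcon
      rw [← Finset.mul_sum, ← hsum, Finset.sum_const, Finset.card_range, smul_eq_mul, hlen] at this
      nlinarith
    set l' := (L.filter fun x => x.2 = i).map Prod.fst with hl'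
    have hsub : l'.Sublist l := by
      rw [← h1]
      exact List.filter_sublist.map _
    have hdec : (l'.map f).Pairwise (· ≥ ·) := by
      rw [List.pairwise_map, hl', List.pairwise_map]
      refine (h3.filter _).imp_of_mem fun {x y} hx hy h => h ?_
      rw [List.mem_filter] at hx hy
      simp only [decide_eq_true_eq] at hx hy
      rw [hx.2, hy.2]
    by_cases hcount : ∀ s, (l'.map f).count s ≤ k
    · right
      refine ⟨l', hsub, hdec, ?_⟩
      have h4 := four_pow_length_le hk _ hdec hcount
      -- The class has at least (k + 1) k / 2 elements, each worth a factor 4 = 2 ^ 2; taking k-th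
      -- roots leaves 2 ^ (k + 1).
      have h5 : (2 ^ (k + 1)) ^ k ≤ countDec (l'.map f) ^ k := by
        refine le_trans ?_ h4
        rw [← pow_mul, show 4 = 2 ^ 2 by norm_num, ← pow_mul]
        refine Nat.pow_le_pow_right (by norm_num) ?_
        simpa [hl'] using hi
      exact (Nat.pow_le_pow_iff_left (by omega)).1 h5
    · left
      push Not at hcount
      obtain ⟨s, hs⟩ := hcount
      have hcl : (l'.map f).count s = (l'.filter fun a => f a = s).length := by
        rw [List.count, List.countP_map, List.countP_eq_length_filter]
        congr 2
      refine ⟨(l'.filter fun a => f a = s).take (k + 1),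
        (List.take_sublist _ _).trans (List.filter_sublist.trans hsub), ?_, s, fun a ha => ?_⟩
      · rw [List.length_take]
        omega
      · simpa using (List.mem_filter.1 (List.mem_of_mem_take ha)).2

/-! ### Perturbing slopes and building words from top to bottom -/

lemma continuous_height (p : Plane) : Continuous fun s => height s p := by
  unfold height; fun_prop

lemma eventually_height_lt (S : Finset Plane) (s : ℝ) :
    ∀ᶠ t in 𝓝 s, ∀ p ∈ S, ∀ q ∈ S, height s q < height s p → height t q < height t p := by
  refine (Finset.eventually_all S).2 fun p _ => (Finset.eventually_all S).2 fun q _ => ?_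
  by_cases h : height s q < height s p
  · filter_upwards [(continuous_height q).continuousAt.eventually_lt
      (continuous_height p).continuousAt h] with t ht _ using ht
  · exact Eventually.of_forall fun t h' => absurd h' h

/-- Strict inequalities survive the perturbation by hypothesis, and a tie at slope `s` between
different points is broken at every other slope, since their abscissas differ. -/
lemma height_injective_of_near {S : Finset Plane} {s t : ℝ} (hts : t ≠ s)
    (h : ∀ p ∈ S, ∀ q ∈ S, height s q < height s p → height t q < height t p) :
    ∀ p ∈ S, ∀ q ∈ S, height t p = height t q → p = q := by
  intro p hp q hq he
  rcases lt_trichotomy (height s p) (height s q) with h1 | h1 | h1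
  · exact absurd he (h q hq p hp h1).ne
  · unfold height at h1 he
    have h0 : (t - s) * (p 0 - q 0) = 0 := by linarith
    have h0' : p 0 = q 0 := by
      rcases mul_eq_zero.1 h0 with h | h
      · exact absurd (sub_eq_zero.1 h) hts
      · exact sub_eq_zero.1 h
    refine plane_ext h0' ?_
    rw [h0'] at h1
    linarith
  · exact absurd he (h p hp q hq h1).ne'

/-- The color words of the right-going rays from the points of `S` with slopes at most `m`, read
from top to bottom. -/
def slopeWords (col : Plane → RayColor) (S : Finset Plane) (m : ℝ) : Set (List RayColor) :=
  {w | ∃ (L : List Plane) (σ : Plane → ℝ), (∀ p, p ∈ L ↔ p ∈ S) ∧ L.Pairwise (IsAbove σ) ∧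
    (∀ p ∈ L, σ p ≤ m) ∧ w = L.map col}

lemma slopeWords_nonempty (col : Plane → RayColor) (S : Finset Plane) (m : ℝ) :
    (slopeWords col S m).Nonempty := by
  obtain ⟨t, h, htm⟩ := (((eventually_height_lt S m).filter_mono nhdsWithin_le_nhds).and
    (self_mem_nhdsWithin (s := Set.Iio m))).exists
  obtain ⟨L, h1, h2⟩ := exists_sorted t S (height_injective_of_near htm.ne h)
  exact ⟨_, L, fun _ => t, h1, h2.imp fun h => ⟨le_rfl, h⟩, fun _ _ => htm.le, rfl⟩

/-- The points of `S` of height at least `c` with respect to the slope `s` can be read first, with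
rays of a slope `t` close to `s`. -/
lemma append_mem_slopeWords {col : Plane → RayColor} {S : Finset Plane} {s t c m : ℝ}
    (h : ∀ p ∈ S, ∀ q ∈ S, height s q < height s p → height t q < height t p) (htm : t ≤ m)
    {L : List Plane} (hL : ∀ p, p ∈ L ↔ p ∈ S.filter fun p => c ≤ height s p)
    (hs : L.Pairwise fun p q => height t q < height t p) {w : List RayColor}
    (hw : w ∈ slopeWords col (S.filter fun p => height s p < c) t) :
    L.map col ++ w ∈ slopeWords col S m := by
  classical
  obtain ⟨M, σ, hM, hσ, hle, rfl⟩ := hw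
  simp only [Finset.mem_filter] at hL hM
  have hdis : ∀ p ∈ M, p ∉ L := fun p hp hp' => not_le.2 ((hM p).1 hp).2 ((hL p).1 hp').2
  refine ⟨L ++ M, fun p => if p ∈ L then t else σ p, fun p => ?_, ?_, fun p hp => ?_,
    by rw [List.map_append]⟩
  · rw [List.mem_append, hL, hM]
    have := le_or_gt c (height s p)
    tauto
  · rw [List.pairwise_append]
    refine ⟨hs.imp_of_mem fun {p q} hp hq h => ?_, hσ.imp_of_mem fun {p q} hp hq h => ?_,
      fun p hp q hq => ?_⟩
    · simp only [IsAbove, if_pos hp, if_pos hq]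
      exact ⟨le_rfl, h⟩
    · simp only [IsAbove, if_neg (hdis p hp), if_neg (hdis q hq)]
      exact h
    · simp only [IsAbove, if_pos hp, if_neg (hdis q hq)]
      have hp' := (hL p).1 hp
      have hq' := (hM q).1 hq
      exact ⟨hle q hq, h p hp'.1 q hq'.1 (hq'.2.trans_le hp'.2)⟩
  · by_cases hpL : p ∈ L
    · simpa [hpL] using htm
    · simp only [if_neg hpL]
      exact (hle p ((List.mem_append.1 hp).resolve_left hpL)).trans htm

lemma exists_eq_append_of_isLeast {t : ℝ} {L : List Plane} {x : Plane}
    (hL : L.Pairwise fun p q => height t q < height t p) (hx : x ∈ L)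
    (hmin : ∀ p ∈ L, p ≠ x → height t x < height t p) : ∃ L', L = L' ++ [x] := by
  rcases List.eq_nil_or_concat' L with rfl | ⟨L', z, rfl⟩
  · simp at hx
  · refine ⟨L', ?_⟩
    by_cases hzx : z = x
    · rw [hzx]
    · have hxL : x ∈ L' := by
        rcases List.mem_append.1 hx with h | h
        · exact h
        · exact absurd (List.mem_singleton.1 h).symm hzx
      have h1 := (List.pairwise_append.1 hL).2.2 x hxL z (by simp)
      exact absurd h1 (lt_asymm (hmin z (by simp) hzx))

/-- The points on or above the line through `a` and `b`, sorted with respect to a slope close to the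
slope of that line: the last one is `a` or `b`, depending on the side of the slope. -/
lemma exists_cell {S : Finset Plane} (hgp : InGeneralPosition (S : Set Plane)) {a b : Plane}
    (ha : a ∈ S) (hb : b ∈ S) {s t : ℝ} (hab : height s b = height s a) (hne : a 0 ≠ b 0)
    (hts : t ≠ s)
    (h : ∀ p ∈ S, ∀ q ∈ S, height s q < height s p → height t q < height t p) :
    ∃ (L : List Plane) (x : Plane),
      (∀ p, p ∈ (L ++ [x]) ↔ p ∈ S.filter fun p => height s a ≤ height s p) ∧
      (L ++ [x]).Pairwise (fun p q => height t q < height t p) ∧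
      (x = a ∧ 0 < (t - s) * (a 0 - b 0) ∨ x = b ∧ 0 < (t - s) * (b 0 - a 0)) := by
  have hinj := height_injective_of_near hts h
  have hab' : a ≠ b := fun h => hne (by rw [h])
  obtain ⟨L, h1, h2⟩ := exists_sorted t (S.filter fun p => height s a ≤ height s p)
    fun p hp q hq => hinj p (Finset.mem_filter.1 hp).1 q (Finset.mem_filter.1 hq).1
  have key : ∀ x y : Plane, x ∈ S → height s x = height s a →
      (∀ p ∈ S, height s p = height s a → p = x ∨ p = y) → height t x < height t y →
      ∃ L', L = L' ++ [x] := by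
    intro x y hx hxa hxy hlt
    refine exists_eq_append_of_isLeast h2 ((h1 x).2 (Finset.mem_filter.2 ⟨hx, hxa.ge⟩)) ?_
    intro p hp hpx
    obtain ⟨hpS, hpa⟩ := Finset.mem_filter.1 ((h1 p).1 hp)
    rcases hpa.lt_or_eq with hpa | hpa
    · exact h p hpS x hx (by rwa [hxa])
    · rcases hxy p hpS hpa.symm with h | h
      · exact absurd h hpx
      · rwa [h]
  have two : ∀ p ∈ S, height s p = height s a → p = a ∨ p = b := fun p hp hpa =>
    eq_or_eq_of_height_eq hgp ha hb hp hab' hab hpa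
  have hsum : height t b - height t a = (t - s) * (a 0 - b 0) := by
    unfold height at hab ⊢
    linarith
  rcases lt_trichotomy (height t a) (height t b) with hlt | heq | hlt
  · obtain ⟨L', rfl⟩ := key a b ha rfl two hlt
    exact ⟨L', a, h1, h2, Or.inl ⟨rfl, by linarith⟩⟩
  · exact absurd (hinj a ha b hb heq) hab'
  · obtain ⟨L', rfl⟩ := key b a hb hab (fun p hp hpa => (two p hp hpa).symm) hlt
    exact ⟨L', b, h1, h2, Or.inr ⟨rfl, by linarith⟩⟩

/-- The two families have prefixes of equal length that differ in their last letter, so no word is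
counted twice. -/
lemma card_image_append_union [DecidableEq (List RayColor)] {F G : Finset (List RayColor)} {u v : List RayColor} {c d : RayColor}
    (hlen : (u ++ [c]).length = (v ++ [d]).length) (hcd : c ≠ d) :
    (F.image (fun w => u ++ [c] ++ w) ∪ G.image (fun w => v ++ [d] ++ w)).card =
      F.card + G.card := by
  rw [Finset.card_union_of_disjoint, Finset.card_image_of_injective _ (List.append_right_injective _),
    Finset.card_image_of_injective _ (List.append_right_injective _)]
  rw [Finset.disjoint_left]
  intro w hw hw'
  obtain ⟨x, -, rfl⟩ := Finset.mem_image.1 hw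
  obtain ⟨y, -, h⟩ := Finset.mem_image.1 hw'
  have h1 := (List.append_inj h hlen.symm).1
  have h2 := (List.append_inj' h1 rfl).2
  exact hcd (List.singleton_inj.1 h2).symm

lemma length_cell_eq {S : Finset Plane} {P Q : List Plane} {t u : ℝ}
    (hP : P.Pairwise fun p q => height t q < height t p)
    (hQ : Q.Pairwise fun p q => height u q < height u p)
    (hPS : ∀ p, p ∈ P ↔ p ∈ S) (hQS : ∀ p, p ∈ Q ↔ p ∈ S) : P.length = Q.length := by
  rw [length_eq_card (nodup_of_pairwise_height hP) hPS,
    length_eq_card (nodup_of_pairwise_height hQ) hQS]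

/-- A stack of bichromatic pairs with weakly decreasing slopes yields many words. -/
lemma exists_finset_slopeWords (col : Plane → RayColor) (l : List (Plane × Plane))
    (S : Finset Plane) (m : ℝ) (hgp : InGeneralPosition (S : Set Plane))
    (hl : ∀ x ∈ l, x.1 ∈ S ∧ x.2 ∈ S ∧ x.1 0 ≠ x.2 0 ∧ col x.1 ≠ col x.2)
    (hbelow : l.Pairwise LiesBelow) (hdec : (l.map slope).Pairwise (· ≥ ·))
    (hm : ∀ x ∈ l, slope x < m) :
    ∃ F : Finset (List RayColor), (∀ w ∈ F, w ∈ slopeWords col S m) ∧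
      countDec (l.map slope) ≤ F.card := by
  classical
  induction hn : l.length using Nat.strong_induction_on generalizing l S m with
  | _ n ih =>
  cases l with
  | nil =>
    obtain ⟨w, hw⟩ := slopeWords_nonempty col S m
    exact ⟨{w}, by simpa using hw, by simp [countDec_nil]⟩
  | cons x r =>
    obtain ⟨ha, hb, hne, hcol⟩ := hl x (by simp)
    have hmx := hm x (by simp)
    set s := slope x with hs
    have hab : height s x.2 = height s x.1 := height_slope hne
    rw [List.map_cons, List.pairwise_cons] at hdec
    rw [List.pairwise_cons] at hbelow
    have near := eventually_height_lt S s
    have hgt : ∀ᶠ t in 𝓝[>] s, s < t := self_mem_nhdsWithin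
    -- The upper choice: `t` exceeds s, so all later pairs, of slope at most s, remain usable under
    -- the bound `t`.
    obtain ⟨t, ht, hst, htm⟩ := ((near.filter_mono nhdsWithin_le_nhds).and
      (hgt.and (mem_nhdsWithin_of_mem_nhds (Iio_mem_nhds hmx)))).exists
    have hlow : ∀ᶠ u in 𝓝[<] s, ∀ y ∈ r, slope y < s → slope y < u := by
      have := (r.finite_toSet.eventually_all (l := 𝓝[<] s)
        (p := fun (y : Plane × Plane) (u : ℝ) => slope y < s → slope y < u)).2 fun y _ => by
          by_cases hy : slope y < s
          · filter_upwards [mem_nhdsWithin_of_mem_nhds (Ioi_mem_nhds hy)] with u hu _ using hu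
          · exact Eventually.of_forall fun u h => absurd h hy
      simpa using this
    have hlt : ∀ᶠ u in 𝓝[<] s, u < s := self_mem_nhdsWithin
    -- The lower choice: `u` is below s but above every later slope that is less than s, so exactly
    -- the pairs of slope s are lost.
    obtain ⟨u, hu, hus, hur⟩ := ((near.filter_mono nhdsWithin_le_nhds).and (hlt.and hlow)).exists
    set D := S.filter fun p => height s p < height s x.1 with hD
    have hgpD : InGeneralPosition (D : Set Plane) := by
      have hsub : ∀ p, p ∈ (D : Set Plane) → p ∈ (S : Set Plane) := fun p hp =>
        Finset.mem_of_mem_filter p (Finset.mem_coe.1 hp)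
      exact fun p hp q hq z hz => hgp p (hsub p hp) q (hsub q hq) z (hsub z hz)
    have hlD : ∀ y ∈ r, y.1 ∈ D ∧ y.2 ∈ D ∧ y.1 0 ≠ y.2 0 ∧ col y.1 ≠ col y.2 := by
      intro y hy
      have h1 := hl y (List.mem_cons_of_mem _ hy)
      have h2 := hbelow.1 y hy
      exact ⟨Finset.mem_filter.2 ⟨h1.1, h2.1⟩, Finset.mem_filter.2 ⟨h1.2.1, h2.2⟩, h1.2.2⟩
    obtain ⟨F, hF, cF⟩ := ih r.length (by simp [← hn]) r D t hgpD hlD hbelow.2 hdec.2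
      (fun y hy => (hdec.1 _ (List.mem_map_of_mem hy)).trans_lt hst) rfl
    have hfil : ((r.map slope).filter (· < s)) = (r.filter (slope · < s)).map slope := by
      rw [List.filter_map]
      rfl
    obtain ⟨G, hG, cG⟩ := ih (r.filter (slope · < s)).length
      (by rw [← hn]; exact Nat.lt_succ_of_le (List.length_filter_le _ _))
      (r.filter (slope · < s)) D u hgpD (fun y hy => hlD y (List.mem_of_mem_filter hy))
      (hbelow.2.filter _) (by rw [← hfil]; exact hdec.2.filter _)
      (fun y hy => hur y (List.mem_of_mem_filter hy) (by simpa using (List.mem_filter.1 hy).2)) rfl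
    obtain ⟨P, p, hP1, hP2, hP3⟩ := exists_cell hgp ha hb hab hne hst.ne' ht
    obtain ⟨Q, q, hQ1, hQ2, hQ3⟩ := exists_cell hgp ha hb hab hne hus.ne hu
    -- The perturbations t - s and u - s have opposite signs, so the two cells end at different
    -- endpoints of the pair.
    have hpq : col p ≠ col q := by
      have pos : 0 < t - s := sub_pos.2 hst
      have neg : u - s < 0 := sub_neg.2 hus
      rcases hP3 with ⟨rfl, h1⟩ | ⟨rfl, h1⟩ <;> rcases hQ3 with ⟨rfl, h2⟩ | ⟨rfl, h2⟩
      · nlinarith [pos_of_mul_pos_right h1 pos.le]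
      · exact hcol
      · exact hcol.symm
      · nlinarith [pos_of_mul_pos_right h1 pos.le]
    have hlen := length_cell_eq hP2 hQ2 hP1 hQ1
    refine ⟨F.image (fun w => P.map col ++ [col p] ++ w) ∪
      G.image (fun w => Q.map col ++ [col q] ++ w), fun w hw => ?_, ?_⟩
    · rcases Finset.mem_union.1 hw with hw | hw
      · obtain ⟨w', hw', rfl⟩ := Finset.mem_image.1 hw
        have := append_mem_slopeWords ht htm.le hP1 hP2 (hF w' hw')
        rwa [List.map_append] at this
      · obtain ⟨w', hw', rfl⟩ := Finset.mem_image.1 hw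
        have := append_mem_slopeWords hu (hus.trans hmx).le hQ1 hQ2 (hG w' hw')
        rwa [List.map_append] at this
    · have hcard := card_image_append_union (F := F) (G := G) (u := P.map col) (v := Q.map col)
        (c := col p) (d := col q) (by simpa using hlen) hpq
      rw [List.map_cons, countDec_cons, hfil]
      exact (Nat.add_le_add cF cG).trans hcard.ge

/-- A stack of bichromatic pairs with equal slopes yields many configurations: one ray of every pair
goes to the left, all other rays go to the right. -/
lemma exists_finset_of_parallel {R B : Finset Plane} {l : List (Plane × Plane)}
    (hl : ∀ x ∈ l, (x.1 ∈ R ∨ x.1 ∈ B) ∧ (x.2 ∈ R ∨ x.2 ∈ B) ∧ x.1 0 ≠ x.2 0 ∧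
      pointColor R x.1 ≠ pointColor R x.2)
    (hbelow : l.Pairwise LiesBelow) {s : ℝ} (hs : ∀ x ∈ l, slope x = s) :
    ∃ F : Finset (List RayColor),
      (∀ w ∈ F, ∃ L : List Plane, L.Nodup ∧ (∀ p, p ∈ L ↔ p ∈ R ∨ p ∈ B) ∧
        w = L.map (pointColor R) ∧ IsFeasible R B (w : Cycle RayColor)) ∧
      2 ^ l.length ≤ F.card := by
  classical
  -- The common slope of the rays is perturbed so that all points lie on different parallel lines,
  -- while the levels of the stack keep their order.
  obtain ⟨t, ht, hts⟩ := (((eventually_height_lt (R ∪ B) s).filter_mono nhdsWithin_le_nhds).and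
    (self_mem_nhdsWithin (s := Set.Ioi s))).exists
  have hinj := height_injective_of_near (Set.mem_Ioi.1 hts).ne' ht
  let pick : (Fin l.length → Bool) → Fin l.length → Plane := fun c i =>
    if c i then (l.get i).1 else (l.get i).2
  have hmem : ∀ c i, pick c i ∈ R ∪ B := by
    intro c i
    have := hl _ (l.get_mem i)
    by_cases h : c i
    · simpa [pick, h] using this.1
    · simpa [pick, h] using this.2.1
  have hheight : ∀ c i, height s (pick c i) = height s (l.get i).1 := by
    intro c i
    by_cases h : c i
    · simp [pick, h]
    · have := height_slope (hl _ (l.get_mem i)).2.2.1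
      rw [hs _ (l.get_mem i)] at this
      simpa [pick, h] using this
  have hlt : ∀ c, (List.ofFn (pick c)).Pairwise fun p q => height t q < height t p := by
    intro c
    rw [List.pairwise_ofFn]
    intro i j hij
    apply ht _ (hmem c i) _ (hmem c j)
    have h1 := List.pairwise_iff_get.1 hbelow i j hij
    rw [LiesBelow, hs _ (l.get_mem i)] at h1
    rw [hheight c i, hheight c j]
    exact h1.1
  have hsorted : ∀ c, ∃ L : List Plane, (∀ p, p ∈ L ↔ p ∈ (R ∪ B) \ (List.ofFn (pick c)).toFinset) ∧
      L.Pairwise fun p q => height t q < height t p := fun c =>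
    exists_sorted t _ fun p hp q hq =>
      hinj p (Finset.mem_sdiff.1 hp).1 q (Finset.mem_sdiff.1 hq).1
  choose L hL1 hL2 using hsorted
  have hsub : ∀ c, ∀ p ∈ List.ofFn (pick c), p ∈ R ∪ B := by
    intro c p hp
    obtain ⟨i, rfl⟩ := (List.mem_ofFn' _ _).1 hp
    exact hmem c i
  have hmem' : ∀ c p, p ∈ L c ++ (List.ofFn (pick c)).reverse ↔ p ∈ R ∪ B := by
    intro c p
    rw [List.mem_append, List.mem_reverse, hL1, Finset.mem_sdiff, List.mem_toFinset]
    have := hsub c p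
    tauto
  have hnd : ∀ c, (L c ++ (List.ofFn (pick c)).reverse).Nodup := by
    intro c
    refine List.nodup_append.2 ⟨nodup_of_pairwise_height (hL2 c),
      List.nodup_reverse.2 (nodup_of_pairwise_height (hlt c)), ?_⟩
    rintro p hp q hq rfl
    rw [hL1, Finset.mem_sdiff, List.mem_toFinset] at hp
    exact hp.2 (List.mem_reverse.1 hq)
  let word : (Fin l.length → Bool) → List RayColor := fun c =>
    (L c ++ (List.ofFn (pick c)).reverse).map (pointColor R)
  refine ⟨Finset.univ.image word, fun w hw => ?_, ?_⟩
  · obtain ⟨c, -, rfl⟩ := Finset.mem_image.1 hw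
    refine ⟨_, hnd c, fun p => by rw [hmem', Finset.mem_union], rfl, ?_⟩
    refine isFeasible_of_parallel (fun p => by rw [hmem', Finset.mem_union]) (hnd c) ?_ (hL2 c)
      (List.pairwise_reverse.2 (hlt c))
    intro p hp q hq
    exact hinj p ((hmem' c p).1 hp) q ((hmem' c q).1 hq)
  · rw [Finset.card_image_of_injective]
    · simp
    · intro c d hcd
      simp only [word, List.map_append, List.map_reverse, List.map_ofFn] at hcd
      -- The left-going rays form a suffix of fixed length, one letter per pair. Since each pair is
      -- bichromatic, the letters determine the choices.
      have h1 := List.reverse_injective (List.append_inj' hcd (by simp)).2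
      have h2 := List.ofFn_injective h1
      funext i
      have h3 := congrFun h2 i
      have h4 := (hl _ (l.get_mem i)).2.2.2
      by_contra hne
      cases hci : c i <;> cases hdi : d i <;> simp [pick, hci, hdi] at h3 hne
      · exact h4 h3.symm
      · exact h4 h3

/-! ### Separating the colors by a vertical line -/

lemma exists_median (R : Finset Plane) (hR : R.Nonempty) :
    ∃ x₀ : ℝ, R.card ≤ 2 * (R.filter fun p => p 0 ≤ x₀).card ∧
      R.card ≤ 2 * (R.filter fun p => x₀ ≤ p 0).card := by
  classical
  -- The median is the leftmost point with at least half of `R` weakly to its left. If fewer than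
  -- half were weakly to its right, the rightmost point strictly to its left would also qualify.
  let T := R.filter fun q => R.card ≤ 2 * (R.filter fun p => p 0 ≤ q 0).card
  have hT : T.Nonempty := by
    obtain ⟨q, hq, hmax⟩ := R.exists_max_image (fun p => p 0) hR
    refine ⟨q, Finset.mem_filter.2 ⟨hq, ?_⟩⟩
    rw [Finset.filter_true_of_mem hmax]
    omega
  obtain ⟨p, hp, hmin⟩ := T.exists_min_image (fun p => p 0) hT
  refine ⟨p 0, (Finset.mem_filter.1 hp).2, ?_⟩
  by_contra! hlt
  have hsplit := Finset.card_filter_add_card_filter_not (s := R) (fun q : Plane => p 0 ≤ q 0)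
  have hne : (R.filter fun q => ¬ p 0 ≤ q 0).Nonempty := Finset.card_pos.1 (by omega)
  obtain ⟨q, hq, hmax⟩ := Finset.exists_max_image _ (fun q => q 0) hne
  obtain ⟨hqR, hqp⟩ := Finset.mem_filter.1 hq
  refine hqp (hmin q (Finset.mem_filter.2 ⟨hqR, ?_⟩))
  have : (R.filter fun q => ¬ p 0 ≤ q 0).card ≤ (R.filter fun z => z 0 ≤ q 0).card :=
    Finset.card_le_card fun z hz =>
      Finset.mem_filter.2 ⟨(Finset.mem_filter.1 hz).1, hmax z hz⟩
  omega

lemma card_filter_fst_eq_le_two {S : Finset Plane} (hgp : InGeneralPosition (S : Set Plane))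
    (x₀ : ℝ) : (S.filter fun p => p 0 = x₀).card ≤ 2 := by
  by_contra! hlt
  obtain ⟨p, q, r, hp, hq, hr, hpq, hpr, hqr⟩ := Finset.two_lt_card_iff.1 hlt
  rw [Finset.mem_filter] at hp hq hr
  exact hgp p hp.1 q hq.1 r hr.1 hpq hpr hqr
    (collinear_of_fst_eq (hq.2.trans hp.2.symm) (hr.2.trans hp.2.symm))

/-- About half of one color class lies to the left, and about half of the other one to the right,
of some vertical line. -/
lemma exists_vertical_separation {n : ℕ} (hn : 1 ≤ n) {R B : Finset Plane}
    (hbal : IsBalancedBichromatic n R B)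
    (hgp : InGeneralPosition ((R : Set Plane) ∪ (B : Set Plane))) :
    ∃ (x₀ : ℝ) (A C : Finset Plane), (∀ a ∈ A, a 0 < x₀) ∧ (∀ c ∈ C, x₀ < c 0) ∧
      n ≤ 2 * A.card + 4 ∧ n ≤ 2 * C.card + 4 ∧ (A ⊆ R ∧ C ⊆ B ∨ A ⊆ B ∧ C ⊆ R) := by
  classical
  obtain ⟨hdis, hR, hB⟩ := hbal
  obtain ⟨x₀, h1, h2⟩ := exists_median R (Finset.card_pos.1 (by omega))
  have h3 : (R.filter fun p => p 0 = x₀).card + (B.filter fun p => p 0 = x₀).card ≤ 2 := by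
    rw [← Finset.card_union_of_disjoint (Finset.disjoint_filter_filter hdis),
      ← Finset.filter_union]
    exact card_filter_fst_eq_le_two (by rwa [Finset.coe_union]) x₀
  have le_split : ∀ X : Finset Plane, (X.filter fun p => p 0 ≤ x₀).card ≤
      (X.filter fun p => p 0 < x₀).card + (X.filter fun p => p 0 = x₀).card := by
    intro X
    refine le_trans (Finset.card_le_card fun p hp => ?_) (Finset.card_union_le _ _)
    obtain ⟨hp1, hp2⟩ := Finset.mem_filter.1 hp
    rcases hp2.lt_or_eq with h | h
    · exact Finset.mem_union_left _ (Finset.mem_filter.2 ⟨hp1, h⟩)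
    · exact Finset.mem_union_right _ (Finset.mem_filter.2 ⟨hp1, h⟩)
  have ge_split : ∀ X : Finset Plane, (X.filter fun p => x₀ ≤ p 0).card ≤
      (X.filter fun p => x₀ < p 0).card + (X.filter fun p => p 0 = x₀).card := by
    intro X
    refine le_trans (Finset.card_le_card fun p hp => ?_) (Finset.card_union_le _ _)
    obtain ⟨hp1, hp2⟩ := Finset.mem_filter.1 hp
    rcases hp2.lt_or_eq with h | h
    · exact Finset.mem_union_left _ (Finset.mem_filter.2 ⟨hp1, h⟩)
    · exact Finset.mem_union_right _ (Finset.mem_filter.2 ⟨hp1, h.symm⟩)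
  have h4 := le_split R
  have h5 := ge_split R
  have h6 := ge_split B
  have h7 := Finset.card_filter_add_card_filter_not (s := B) (fun p : Plane => p 0 < x₀)
  simp only [not_lt] at h7
  have mlt : ∀ X : Finset Plane, ∀ a ∈ X.filter (fun p => p 0 < x₀), a 0 < x₀ := fun X a ha =>
    (Finset.mem_filter.1 ha).2
  have mgt : ∀ X : Finset Plane, ∀ a ∈ X.filter (fun p => x₀ < p 0), x₀ < a 0 := fun X a ha =>
    (Finset.mem_filter.1 ha).2
  -- At most two points lie on the line itself, which costs the additive 4. If too few blue points
  -- lie on the right, enough lie on the left, and the colors exchange roles.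
  by_cases hc : n ≤ 2 * (B.filter fun p => x₀ < p 0).card + 4
  · exact ⟨x₀, _, _, mlt R, mgt B, by omega, hc,
      Or.inl ⟨Finset.filter_subset _ _, Finset.filter_subset _ _⟩⟩
  · exact ⟨x₀, _, _, mlt B, mgt R, by omega, by omega,
      Or.inr ⟨Finset.filter_subset _ _, Finset.filter_subset _ _⟩⟩

/-! ### From slope patterns to the lower bound -/

lemma pointColor_ne {R B : Finset Plane} (h : Disjoint R B) {p q : Plane} (hp : p ∈ R)
    (hq : q ∈ B) : pointColor R p ≠ pointColor R q := by
  simp [pointColor, hp, Finset.disjoint_right.1 h hq]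

lemma length_map_eq {n : ℕ} {R B : Finset Plane} (hbal : IsBalancedBichromatic n R B)
    {L : List Plane} (hnd : L.Nodup) (hL : ∀ p, p ∈ L ↔ p ∈ R ∨ p ∈ B) :
    (L.map (pointColor R)).length = 2 * n := by
  classical
  obtain ⟨h1, h2, h3⟩ := hbal
  rw [List.length_map, length_eq_card hnd (F := R ∪ B) (by simpa using hL),
    Finset.card_union_of_disjoint h1]
  omega

lemma countDec_le_gammaCount {n : ℕ} (hn : 1 ≤ n) {R B : Finset Plane}
    (hbal : IsBalancedBichromatic n R B)
    (hgp : InGeneralPosition ((R : Set Plane) ∪ (B : Set Plane))) {l : List (Plane × Plane)}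
    (hl : ∀ x ∈ l, (x.1 ∈ R ∨ x.1 ∈ B) ∧ (x.2 ∈ R ∨ x.2 ∈ B) ∧ x.1 0 ≠ x.2 0 ∧
      pointColor R x.1 ≠ pointColor R x.2)
    (hbelow : l.Pairwise LiesBelow) (hdec : (l.map slope).Pairwise (· ≥ ·)) :
    countDec (l.map slope) ≤ 2 * n * gammaCount R B := by
  classical
  obtain ⟨m, hm⟩ := (l.finite_toSet.image slope).bddAbove
  obtain ⟨F, hF, hcard⟩ := exists_finset_slopeWords (pointColor R) l (R ∪ B) (m + 1)
    (by rwa [Finset.coe_union]) (by simpa only [Finset.mem_union] using hl) hbelow hdec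
    fun x hx => (hm (Set.mem_image_of_mem slope hx)).trans_lt (lt_add_one m)
  refine hcard.trans (card_le_mul_gammaCount (by omega) F fun w hw => ?_)
  obtain ⟨L, σ, hL, hσ, -, rfl⟩ := hF w hw
  simp only [Finset.mem_union] at hL
  exact ⟨length_map_eq hbal (nodup_of_pairwise_isAbove hσ) hL,
    isFeasible_of_pairwise_isAbove hL hσ⟩

lemma one_le_gammaCount {n : ℕ} (hn : 1 ≤ n) {R B : Finset Plane}
    (hbal : IsBalancedBichromatic n R B)
    (hgp : InGeneralPosition ((R : Set Plane) ∪ (B : Set Plane))) : 1 ≤ gammaCount R B := by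
  -- The empty stack already yields one word.
  have := countDec_le_gammaCount hn hbal hgp (l := []) (by simp) List.Pairwise.nil
    List.Pairwise.nil
  rw [List.map_nil, countDec_nil] at this
  exact Nat.pos_of_mul_pos_left this

lemma slope_mirror (x : Plane × Plane) : slope (mirror x.1, mirror x.2) = -slope x := by
  simp only [slope, mirror_zero, mirror_one]
  rw [← div_neg]
  congr 1
  ring

lemma height_neg_mirror (s : ℝ) (p : Plane) : height (-s) (mirror p) = height s p := by
  simp [height]

lemma liesBelow_mirror {x y : Plane × Plane} (h : LiesBelow x y) :
    LiesBelow (mirror x.1, mirror x.2) (mirror y.1, mirror y.2) := by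
  simpa only [LiesBelow, slope_mirror, height_neg_mirror] using h

/-- Reflection negates slopes and keeps the stack order, so the slopes become strictly decreasing
and every sublist counts. -/
lemma two_pow_le_of_increasing {n : ℕ} (hn : 1 ≤ n) {R B : Finset Plane}
    (hbal : IsBalancedBichromatic n R B)
    (hgp : InGeneralPosition ((R : Set Plane) ∪ (B : Set Plane))) {l : List (Plane × Plane)}
    (hl : ∀ x ∈ l, (x.1 ∈ R ∨ x.1 ∈ B) ∧ (x.2 ∈ R ∨ x.2 ∈ B) ∧ x.1 0 ≠ x.2 0 ∧
      pointColor R x.1 ≠ pointColor R x.2)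
    (hbelow : l.Pairwise LiesBelow) (hinc : l.Pairwise fun x y => slope x < slope y) :
    2 ^ l.length ≤ 2 * n * gammaCount R B := by
  have hbal' : IsBalancedBichromatic n (R.map mirror.toEmbedding) (B.map mirror.toEmbedding) :=
    ⟨(Finset.disjoint_map _).2 hbal.1, by rw [Finset.card_map, hbal.2.1],
      by rw [Finset.card_map, hbal.2.2]⟩
  let l' := l.map fun x => (mirror x.1, mirror x.2)
  have hgt : (l'.map slope).Pairwise (· > ·) := by
    rw [List.pairwise_map, List.pairwise_map]
    refine hinc.imp fun {x y} h => ?_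
    rw [slope_mirror, slope_mirror]
    exact neg_lt_neg h
  have h := countDec_le_gammaCount hn hbal' (inGeneralPosition_mirror hgp) (l := l') (by
      intro y hy
      obtain ⟨x, hx, rfl⟩ := List.mem_map.1 hy
      simpa [mem_map_mirror, pointColor_mirror] using hl x hx)
    (List.pairwise_map.2 (hbelow.imp liesBelow_mirror)) (hgt.imp le_of_lt)
  rw [countDec_of_pairwise_gt hgt, List.length_map, List.length_map] at h
  exact h.trans (Nat.mul_le_mul_left _ (gammaCount_mirror_le R B))

lemma two_pow_le_gammaCount {n k : ℕ} (hk : 3 ≤ k) (hkn : (k + 1) ^ 3 ≤ n) {R B : Finset Plane}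
    (hbal : IsBalancedBichromatic n R B)
    (hgp : InGeneralPosition ((R : Set Plane) ∪ (B : Set Plane))) :
    2 ^ (k + 1) ≤ 2 * n * gammaCount R B := by
  have hn : 1 ≤ n := le_trans (Nat.one_le_pow _ _ (by omega)) hkn
  obtain ⟨x₀, A, C, hA, hC, cA, cC, hAC⟩ := exists_vertical_separation hn hbal hgp
  have hA' : ∀ p ∈ A, p ∈ R ∨ p ∈ B := fun p hp => by
    rcases hAC with h | h
    · exact Or.inl (h.1 hp)
    · exact Or.inr (h.1 hp)
  have hC' : ∀ p ∈ C, p ∈ R ∨ p ∈ B := fun p hp => by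
    rcases hAC with h | h
    · exact Or.inr (h.2 hp)
    · exact Or.inl (h.2 hp)
  have hsub : ∀ p, p ∈ (A : Set Plane) ∪ C → p ∈ (R : Set Plane) ∪ B := fun p hp =>
    hp.elim (hA' p) (hC' p)
  obtain ⟨l, hlen, hmem, hbelow⟩ := exists_stack (min A.card C.card) A C hA hC
    (fun p hp q hq r hr => hgp p (hsub p hp) q (hsub q hq) r (hsub r hr))
    (min_le_left _ _) (min_le_right _ _)
  have hl : ∀ x ∈ l, (x.1 ∈ R ∨ x.1 ∈ B) ∧ (x.2 ∈ R ∨ x.2 ∈ B) ∧ x.1 0 ≠ x.2 0 ∧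
      pointColor R x.1 ≠ pointColor R x.2 := by
    intro x hx
    obtain ⟨h1, h2⟩ := hmem x hx
    refine ⟨hA' _ h1, hC' _ h2, ((hA _ h1).trans (hC _ h2)).ne, ?_⟩
    rcases hAC with h | h
    · exact pointColor_ne hbal.1 (h.1 h1) (h.2 h2)
    · exact (pointColor_ne hbal.1 (h.2 h2) (h.1 h1)).symm
  have hbound : (k + 1) * k ^ 2 ≤ 2 * l.length := by
    have h1 : n ≤ 2 * l.length + 4 := by
      rw [hlen]
      rcases min_choice A.card C.card with h | h <;> omega
    -- The lost 4 is absorbed by (k + 1)^3 - (k + 1) k^2 = (k + 1)(2k + 1).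
    nlinarith
  rcases exists_sublist_trichotomy slope l hk hbound with
    ⟨l', hs, hlen', hinc⟩ | ⟨l', hs, hlen', s, heq⟩ | ⟨l', hs, hdec, hcount⟩
  · rw [← hlen']
    exact two_pow_le_of_increasing hn hbal hgp (fun x hx => hl x (hs.subset hx))
      (hbelow.sublist hs) hinc
  · obtain ⟨F, hF, hcard⟩ := exists_finset_of_parallel (fun x hx => hl x (hs.subset hx))
      (hbelow.sublist hs) heq
    rw [hlen'] at hcard
    refine hcard.trans (card_le_mul_gammaCount (by omega) F fun w hw => ?_)
    obtain ⟨L, hnd, hL, rfl, hfeas⟩ := hF w hw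
    exact ⟨length_map_eq hbal hnd hL, hfeas⟩
  · exact hcount.trans (countDec_le_gammaCount hn hbal hgp (fun x hx => hl x (hs.subset hx))
      (hbelow.sublist hs) hdec)

lemma lower_bound {n : ℕ} (hn : 1 ≤ n) {R B : Finset Plane} (hbal : IsBalancedBichromatic n R B)
    (hgp : InGeneralPosition ((R : Set Plane) ∪ (B : Set Plane))) :
    1 / 16 * ((2 : ℝ) ^ ((n : ℝ) ^ ((1 : ℝ) / 3)) / (n : ℝ)) ≤ (gammaCount R B : ℝ) := by
  have hn' : (1 : ℝ) ≤ n := by exact_mod_cast hn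
  set x : ℝ := (n : ℝ) ^ ((1 : ℝ) / 3) with hx
  have hx0 : 0 ≤ x := by positivity
  have hx3 : x ^ 3 = n := by
    rw [hx, ← Real.rpow_natCast, ← Real.rpow_mul (by positivity)]
    norm_num
  rw [← mul_div_assoc, div_le_iff₀ (by linarith)]
  -- Below 4 the bound γ ≥ 1 suffices and dictates the constant 1/16, as 2^4 = 16. From 4 on, k + 1
  -- = ⌊x⌋ gives k ≥ 3, and rounding costs only a factor 2.
  rcases lt_or_ge x 4 with h4 | h4
  · have h1 : (1 : ℝ) ≤ gammaCount R B := by exact_mod_cast one_le_gammaCount hn hbal hgp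
    have h2 : (2 : ℝ) ^ x ≤ 2 ^ (4 : ℝ) := Real.rpow_le_rpow_of_exponent_le (by norm_num) h4.le
    have h3 : (2 : ℝ) ^ (4 : ℝ) = 16 := by norm_num
    nlinarith
  · have hfl : 4 ≤ ⌊x⌋₊ := Nat.le_floor (by exact_mod_cast h4)
    obtain ⟨k, hk⟩ : ∃ k, ⌊x⌋₊ = k + 1 := ⟨⌊x⌋₊ - 1, by omega⟩
    have hkx : ((k : ℝ) + 1) ≤ x := by
      have := Nat.floor_le hx0
      rw [hk] at this
      exact_mod_cast this
    have hkn : (k + 1) ^ 3 ≤ n := by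
      have : ((k : ℝ) + 1) ^ 3 ≤ n := hx3 ▸ pow_le_pow_left₀ (by positivity) hkx 3
      exact_mod_cast this
    have h1 : (2 : ℝ) ^ (k + 1) ≤ 2 * n * gammaCount R B := by
      exact_mod_cast two_pow_le_gammaCount (by omega) hkn hbal hgp
    have h2 : (2 : ℝ) ^ x ≤ 2 ^ (k + 1) * 2 := by
      have h3 : x ≤ ((k + 2 : ℕ) : ℝ) := by
        have := Nat.lt_floor_add_one x
        rw [hk] at this
        push_cast at this ⊢
        linarith
      calc (2 : ℝ) ^ x ≤ 2 ^ ((k + 2 : ℕ) : ℝ) :=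
            Real.rpow_le_rpow_of_exponent_le (by norm_num) h3
        _ = 2 ^ (k + 1) * 2 := by rw [Real.rpow_natCast, pow_succ]
    have h5 : (0 : ℝ) ≤ gammaCount R B * n := by positivity
    linarith

/-! ### Existence of balanced sets in general position -/

/-- The point with abscissa `i` on the standard parabola. -/
noncomputable def parabolaPoint (i : ℕ) : Plane := !₂[(i : ℝ), (i : ℝ) ^ 2]

lemma parabolaPoint_injective : Function.Injective parabolaPoint := fun i j h => by
  simpa [parabolaPoint] using congrArg (fun z : Plane => z 0) h

lemma not_collinear_parabolaPoint {i j k : ℕ} (hij : i ≠ j) (hik : i ≠ k) (hjk : j ≠ k) :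
    ¬ Collinear ℝ {parabolaPoint i, parabolaPoint j, parabolaPoint k} := by
  intro h
  rw [collinear_iff_of_mem (p₀ := parabolaPoint i) (by simp)] at h
  obtain ⟨v, hv⟩ := h
  obtain ⟨s, hs⟩ := hv (parabolaPoint j) (by simp)
  obtain ⟨t, ht⟩ := hv (parabolaPoint k) (by simp)
  have s0 := congrArg (fun z : Plane => z 0) hs
  have s1 := congrArg (fun z : Plane => z 1) hs
  have t0 := congrArg (fun z : Plane => z 0) ht
  have t1 := congrArg (fun z : Plane => z 1) ht
  simp [parabolaPoint] at s0 s1 t0 t1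
  have key : ((j : ℝ) - i) * (k - i) * (k - j) = 0 := by
    have e1 : (j : ℝ) - i = s * v 0 := by linarith
    have e2 : (k : ℝ) - i = t * v 0 := by linarith
    have e3 : (j : ℝ) ^ 2 - i ^ 2 = s * v 1 := by linarith
    have e4 : (k : ℝ) ^ 2 - i ^ 2 = t * v 1 := by linarith
    have : ((j : ℝ) - i) * ((k : ℝ) ^ 2 - i ^ 2) = (k - i) * ((j : ℝ) ^ 2 - i ^ 2) := by
      rw [e1, e2, e3, e4]; ring
    linear_combination this
  have c1 : (j : ℝ) - i ≠ 0 := sub_ne_zero.2 (by exact_mod_cast hij.symm)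
  have c2 : (k : ℝ) - i ≠ 0 := sub_ne_zero.2 (by exact_mod_cast hik.symm)
  have c3 : (k : ℝ) - j ≠ 0 := sub_ne_zero.2 (by exact_mod_cast hjk.symm)
  exact mul_ne_zero (mul_ne_zero c1 c2) c3 key

lemma exists_balanced_inGeneralPosition (n : ℕ) : ∃ R B : Finset Plane,
    IsBalancedBichromatic n R B ∧ InGeneralPosition ((R : Set Plane) ∪ (B : Set Plane)) := by
  refine ⟨(Finset.range n).map ⟨parabolaPoint, parabolaPoint_injective⟩,
    (Finset.Ico n (2 * n)).map ⟨parabolaPoint, parabolaPoint_injective⟩, ⟨?_, ?_, ?_⟩, ?_⟩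
  · rw [Finset.disjoint_map, Finset.disjoint_left]
    intro i hi hi'
    rw [Finset.mem_range] at hi
    rw [Finset.mem_Ico] at hi'
    omega
  · simp
  · simp; omega
  · have key : ∀ p ∈ (((Finset.range n).map ⟨parabolaPoint, parabolaPoint_injective⟩ :
        Finset Plane) : Set Plane) ∪ (((Finset.Ico n (2 * n)).map
        ⟨parabolaPoint, parabolaPoint_injective⟩ : Finset Plane) : Set Plane),
        ∃ i, parabolaPoint i = p := by
      rintro p (hp | hp)
      · obtain ⟨i, -, rfl⟩ := Finset.mem_map.1 (Finset.mem_coe.1 hp)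
        exact ⟨i, rfl⟩
      · obtain ⟨i, -, rfl⟩ := Finset.mem_map.1 (Finset.mem_coe.1 hp)
        exact ⟨i, rfl⟩
    intro p hp q hq r hr hpq hpr hqr
    obtain ⟨i, rfl⟩ := key p hp
    obtain ⟨j, rfl⟩ := key q hq
    obtain ⟨k, rfl⟩ := key r hr
    exact not_collinear_parabolaPoint (fun h => hpq (by rw [h])) (fun h => hpr (by rw [h]))
      (fun h => hqr (by rw [h]))

end ColoredRays

theorem mainTheorem4 :
    (∃ c : ℝ, 0 < c ∧ ∀ n : ℕ, 1 ≤ n → ∀ R B : Finset Plane,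
      IsBalancedBichromatic n R B →
      InGeneralPosition ((R : Set Plane) ∪ (B : Set Plane)) →
      c * ((2 : ℝ) ^ ((n : ℝ) ^ ((1 : ℝ) / 3)) / (n : ℝ)) ≤ (gammaCount R B : ℝ)) ∧
    (fun n : ℕ => (2 : ℝ) ^ ((n : ℝ) ^ ((1 : ℝ) / 3)) / (n : ℝ))
      =O[Filter.atTop] (fun n : ℕ => (gammaMinGP n : ℝ)) := by
  refine ⟨⟨1 / 16, by norm_num, fun n hn R B hbal hgp => ColoredRays.lower_bound hn hbal hgp⟩, ?_⟩
  refine Asymptotics.IsBigO.of_bound 16 ?_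
  filter_upwards [Filter.eventually_ge_atTop 1] with n hn
  -- An example is needed for the minimum to be attained: the infimum of an empty set of naturals
  -- would be 0, and the bound would fail.
  obtain ⟨R₀, B₀, h₀⟩ := ColoredRays.exists_balanced_inGeneralPosition n
  obtain ⟨R, B, hbal, hgp, hmin⟩ := Nat.sInf_mem
    (s := {k : ℕ | ∃ R B : Finset Plane, IsBalancedBichromatic n R B ∧
      InGeneralPosition ((R : Set Plane) ∪ (B : Set Plane)) ∧ gammaCount R B = k})
    ⟨_, R₀, B₀, h₀.1, h₀.2, rfl⟩
  have h := ColoredRays.lower_bound hn hbal hgp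
  rw [hmin] at h
  rw [Real.norm_of_nonneg (by positivity), Real.norm_of_nonneg (by positivity)]
  change _ ≤ 16 * ((gammaMinGP n : ℕ) : ℝ)
  unfold gammaMinGP
  linarith
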